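/- **Setting.** Let $\mathcal S,\mathcal A$ be measurable spaces, and consider an MDP with Markov transition kernel $\mathcal P$, initial distribution $\rho$, discount $\gamma\in[0,1)$ and measurable reward with $|\mathcal R(s,a)|\le \mathcal R_{\max}$. Let $\{\pi_\theta:\theta\in\mathbb R^d\}$ be policies given by densities $\pi_\theta(a\mid s)$ with respect to a $\sigma$-finite measure on $\mathcal A$, measurable in $(s,a)$, differentiable in $\theta$, and such that the set where $\pi_\theta(a\mid s)>0$ does not depend on $\theta$. Let $p(\cdot\mid\theta)$ be the law of the trajectory $\tau=(s_0,a_0,s_1,a_1,\dots)$ with $s_0\sim\rho$, $a_t\sim\pi_\theta(\cdot\mid s_t)$, $s_{t+1}\sim\mathcal P(\cdot\mid s_t,a_t)$, and let $$J(\theta)=\mathbb E_{\tau\sim p(\cdot\mid\theta)}\Big[\sum_{t\ge0}\gamma^t\mathcal R(s_t,a_t)\Big],\quad J^*=\sup_\theta J(\theta),\quad \delta_0=J^*-J(\theta_0).$$ For a horizon $H\in\mathbb N$ and a batch size $m\ge1$, let $\widehat\nabla_mJ(\theta)=\frac1m\sum_{i=1}^m g(\tau_i\mid\theta)$ with $\tau_1,\dots,\tau_m$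 i.i.d. from $p(\cdot\mid\theta)$, where $g(\tau\mid\theta)$ is $$\sum_{t=0}^{H-1}\gamma^t\mathcal R(s_t,a_t)\sum_{t'=0}^{H-1}\nabla_\theta\log\pi_\theta(a_{t'}\mid s_{t'})\ \text{(REINFORCE)}\quad\text{or}\quad \sum_{t=0}^{H-1}\gamma^t\mathcal R(s_t,a_t)\sum_{k=0}^{t}\nabla_\theta\log\pi_\theta(a_k\mid s_k)\ \text{(GPOMDP)}.$$ Vanilla policy gradient started at $\theta_0$ with step size $\eta>0$ is $\theta_{t+1}=\theta_t+\eta\widehat\nabla_mJ(\theta_t)$, with fresh trajectories at every step. For $T\ge1$ let $U$ be uniform on $\{0,\dots,T-1\}$, independent of the iterates. Assume (E-LS): $\log\pi_\theta(a\mid s)$ is twice differentiable in $\theta$ and there are $G,F>0$ with $\mathbb E_{a\sim\pi_\theta(\cdot\mid s)}\|\nabla_\theta\log\pi_\theta(a\mid s)\|^2\le G^2$ and $\mathbb E_{a\sim\pi_\theta(\cdot\mid s)}\|\nabla^2_\theta\log\pi_\theta(a\mid s)\|\le F$ for all $\theta,s$. Put $$L=\frac{\mathcal R_{\max}(G^2+F)}{(1-\gamma)^2},\quad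 \nu=\frac{HG^2\mathcal R_{\max}^2}{(1-\gamma)^2}\ \text{(REINFORCE)},\quad \nu=\frac{G^2\mathcal R_{\max}^2}{(1-\gamma)^3}\ \text{(GPOMDP)},$$ $$D'=\frac{G\mathcal R_{\max}}{1-\gamma}\sqrt{\frac1{1-\gamma}+H},\quad D=\frac{D'G\mathcal R_{\max}}{(1-\gamma)^{3/2}}.$$ **Claim.** There are an absolute constant $c>0$, constants $K$ depending only on $(G,F,\mathcal R_{\max})$ and $C$ depending only on $(G,F,\mathcal R_{\max},\gamma)$ such that in the above setting $J$ is differentiable and bounded above and, for both estimators and every $\theta_0$: 1. For all $H$, $m\ge1$, $T\ge1$ and $\eta>0$ with $y:=L\eta(1-\frac1m)<2$, $$\mathbb E\|\nabla J(\theta_U)\|^2\le\frac{2\delta_0}{\eta T(2-y)}+\frac{L\nu\eta}{m(2-y)}+\Big(\frac{2D(3-y)}{2-y}+D'^2\gamma^H\Big)\gamma^H.$$ 2. For all $\epsilon>0$, $H\ge c\,\frac{\log(1/\epsilon)}{1-\gamma}$, $1\le m\le\frac{2\nu}{\epsilon^2}$, $\eta=\frac{\epsilon^2m}{2L\nu}$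 and $T\ge1$ with $Tm\ge\frac{8\delta_0L\nu}{\epsilon^4}$: $\ \mathbb E\|\nabla J(\theta_U)\|^2\le C\epsilon^2$. 3. For all $\epsilon>0$ and $H$, $\frac{8\delta_0L\nu}{\epsilon^4}\le K\delta_0\frac{H}{(1-\gamma)^4\epsilon^4}$ for REINFORCE and $\frac{8\delta_0L\nu}{\epsilon^4}\le K\delta_0\frac{1}{(1-\gamma)^5\epsilon^4}$ for GPOMDP. 4. (Total sample complexity $\widetilde{\mathcal O}(\epsilon^{-4})$.) For all $0<\epsilon\le\frac12$, with $H=\big\lceil c\,\frac{\log(1/\epsilon)}{1-\gamma}\big\rceil$ and any $1\le m\le\frac{2\nu}{\epsilon^2}$, some $T\ge1$ with $Tm\ge\frac{8\delta_0L\nu}{\epsilon^4}$ achieves, with $\eta=\frac{\epsilon^2m}{2L\nu}$, both $\mathbb E\|\nabla J(\theta_U)\|^2\le C\epsilon^2$ and $$T\cdot m\cdot H\le K(1+\delta_0)\frac{(\log(1/\epsilon))^{q}}{(1-\gamma)^6\epsilon^4},\qquad q=2\text{ for REINFORCE},\ q=1\text{ for GPOMDP}.$$ -/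

import Mathlib

open MeasureTheory ProbabilityTheory Filter Topology
open scoped ENNReal

universe u v

namespace PolicyGradient

/-- The parameter space `ℝ^d` with its Euclidean structure. -/
abbrev Param (d : ℕ) : Type := EuclideanSpace ℝ (Fin d)

/-- Infinite trajectories `(s₀, a₀), (s₁, a₁), …`. -/
abbrev Traj (S : Type u) (A : Type v) : Type (max u v) := ℕ → S × A

/-- A discounted Markov decision process on measurable state and action spaces. The reward is
bounded in absolute value by `Rmax`. -/
structure MDP (S : Type u) (A : Type v) [MeasurableSpace S] [MeasurableSpace A] where
  transition : Kernel (S × A) S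
  markov_transition : IsMarkovKernel transition
  reward : S × A → ℝ
  measurable_reward : Measurable reward
  Rmax : ℝ
  abs_reward_le : ∀ x, |reward x| ≤ Rmax
  γ : ℝ
  γ_nonneg : 0 ≤ γ
  γ_lt_one : γ < 1
  init : Measure S
  prob_init : IsProbabilityMeasure init

/-- A parametrized family of policies `θ ↦ π_θ(a ∣ s)`, `θ ∈ ℝ^d`: for all `θ` and `s`,
`π_θ(· ∣ s)` is a probability density with respect to a fixed σ-finite measure on the action space,
it is differentiable in `θ`, and the set on which it vanishes does not depend on `θ`. -/
structure Policy (d : ℕ) (S : Type u) (A : Type v) [MeasurableSpace S] [MeasurableSpace A] where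
  ref : Measure A
  sigmaFinite_ref : SigmaFinite ref
  density : Param d → S → A → ℝ
  measurable_density : ∀ θ, Measurable fun x : S × A => density θ x.1 x.2
  density_nonneg : ∀ θ s a, 0 ≤ density θ s a
  density_pos : ∀ θ θ' s a, 0 < density θ s a → 0 < density θ' s a
  lintegral_density : ∀ θ s, ∫⁻ a, ENNReal.ofReal (density θ s a) ∂ref = 1
  differentiable_density : ∀ s a, Differentiable ℝ fun θ => density θ s a

attribute [instance] MDP.markov_transition MDP.prob_init Policy.sigmaFinite_ref

section

variable {d : ℕ} {S : Type u} {A : Type v} [MeasurableSpace S] [MeasurableSpace A]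

/-! The policy as a Markov kernel, and its score. -/

theorem Policy.measurable_density_joint (π : Policy d S A) :
    Measurable fun p : Param d × (S × A) => π.density p.1 p.2.1 p.2.2 :=
  measurable_uncurry_of_continuous_of_measurable
    (u := fun (θ : Param d) (x : S × A) => π.density θ x.1 x.2)
    (fun x => (π.differentiable_density x.1 x.2).continuous) π.measurable_density

/-- The kernel `(θ, s) ↦ π_θ(· ∣ s)`. -/
noncomputable def Policy.kernel (π : Policy d S A) : Kernel (Param d × S) A :=
  Kernel.withDensity (Kernel.const _ π.ref)
    (fun p a => ENNReal.ofReal (π.density p.1 p.2 a))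

theorem Policy.kernel_apply (π : Policy d S A) (p : Param d × S) :
    π.kernel p = π.ref.withDensity fun a => ENNReal.ofReal (π.density p.1 p.2 a) := by
  have h : Measurable (Function.uncurry fun (p : Param d × S) (a : A) =>
      ENNReal.ofReal (π.density p.1 p.2 a)) :=
    ENNReal.measurable_ofReal.comp (π.measurable_density_joint.comp
      (f := fun q : (Param d × S) × A => (q.1.1, (q.1.2, q.2))) (by fun_prop))
  rw [Policy.kernel, Kernel.withDensity_apply _ h, Kernel.const_apply]

instance (π : Policy d S A) : IsMarkovKernel π.kernel := by
  refine ⟨fun p => ⟨?_⟩⟩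
  rw [Policy.kernel_apply, withDensity_apply _ MeasurableSet.univ, Measure.restrict_univ]
  exact π.lintegral_density p.1 p.2

/-- The policy `π_θ` as a Markov kernel from states to actions. -/
noncomputable def Policy.at (π : Policy d S A) (θ : Param d) : Kernel S A :=
  π.kernel.comap (fun s => (θ, s)) (by fun_prop)

instance (π : Policy d S A) (θ : Param d) : IsMarkovKernel (π.at θ) := by
  unfold Policy.at; infer_instance

/-- The score `∇_θ log π_θ(a ∣ s)`. -/
noncomputable def Policy.score (π : Policy d S A) (θ : Param d) (x : S × A) : Param d :=
  gradient (fun θ' => Real.log (π.density θ' x.1 x.2)) θ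

/-- The Hessian `∇²_θ log π_θ(a ∣ s)`, as a linear operator on `ℝ^d`. -/
noncomputable def Policy.hessLog (π : Policy d S A) (θ : Param d) (x : S × A) :
    Param d →L[ℝ] Param d :=
  fderiv ℝ (fun θ' => π.score θ' x) θ

/-- Expected Lipschitz and smooth policies with constants `G, F > 0`: `log π_θ(a ∣ s)` is twice
differentiable in `θ`, and for all `θ` and `s`, `E_{a ∼ π_θ(·∣s)} ‖∇ log π_θ(a ∣ s)‖² ≤ G²` and
`E_{a ∼ π_θ(·∣s)} ‖∇² log π_θ(a ∣ s)‖ ≤ F` (operator norm). -/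
structure Policy.IsELS (π : Policy d S A) (G F : ℝ) : Prop where
  G_pos : 0 < G
  F_pos : 0 < F
  differentiable_score : ∀ x, Differentiable ℝ fun θ => π.score θ x
  score_sq_le : ∀ θ s, ∫⁻ a, ‖π.score θ (s, a)‖ₑ ^ 2 ∂(π.at θ s) ≤ ENNReal.ofReal (G ^ 2)
  hessLog_le : ∀ θ s, ∫⁻ a, ‖π.hessLog θ (s, a)‖ₑ ∂(π.at θ s) ≤ ENNReal.ofReal F

theorem Policy.differentiable_log (π : Policy d S A) (x : S × A) :
    Differentiable ℝ fun θ => Real.log (π.density θ x.1 x.2) := by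
  intro θ
  by_cases h : 0 < π.density θ x.1 x.2
  · exact (π.differentiable_density x.1 x.2 θ).log h.ne'
  · have h0 : (fun θ => Real.log (π.density θ x.1 x.2)) = fun _ => 0 := by
      funext θ'
      have h1 : ¬ 0 < π.density θ' x.1 x.2 := fun h' => h (π.density_pos _ _ _ _ h')
      rw [le_antisymm (not_lt.1 h1) (π.density_nonneg _ _ _), Real.log_zero]
    rw [h0]
    exact differentiableAt_const _

theorem Policy.measurable_score (π : Policy d S A) :
    Measurable fun p : Param d × (S × A) => π.score p.1 p.2 := by
  have hc : Measurable fun (p : Param d × (S × A)) => WithLp.ofLp (π.score p.1 p.2) := by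
    refine measurable_pi_iff.2 fun i => ?_
    let e : Param d := EuclideanSpace.single i 1
    let f : S × A → Param d → ℝ := fun x θ => Real.log (π.density θ x.1 x.2)
    have hf : Measurable fun p : Param d × (S × A) => f p.2 p.1 :=
      Real.measurable_log.comp π.measurable_density_joint
    have hm : ∀ n : ℕ, Measurable fun p : Param d × (S × A) =>
        (n : ℝ) * (f p.2 (p.1 + (n : ℝ)⁻¹ • e) - f p.2 p.1) := fun n =>
      ((hf.comp (f := fun p : Param d × (S × A) => (p.1 + (n : ℝ)⁻¹ • e, p.2))
        (by fun_prop)).sub hf).const_mul _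
    refine measurable_of_tendsto_metrizable hm (tendsto_pi_nhds.2 fun p => ?_)
    have h := ((π.differentiable_log p.2 p.1).hasFDerivAt.lim_real e).comp
      (tendsto_natCast_atTop_atTop (R := ℝ))
    have h3 : WithLp.ofLp (π.score p.1 p.2) i = fderiv ℝ (f p.2) p.1 e := by
      have h4 : inner ℝ (π.score p.1 p.2) e = WithLp.ofLp (π.score p.1 p.2) i := by
        simpa using EuclideanSpace.inner_single_right i (1 : ℝ) (π.score p.1 p.2)
      rw [← h4, Policy.score, gradient, InnerProductSpace.toDual_symm_apply]
    rw [h3]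
    exact h
  exact (MeasurableEquiv.toLp 2 (Fin d → ℝ)).measurable.comp hc

/-! The law of the trajectories and the expected return. -/

/-- Law of `(s_{t+1}, a_{t+1})` given `(s_t, a_t)` under the policy `π_θ`. -/
noncomputable def stepKernel (M : MDP S A) (π : Policy d S A) (θ : Param d) :
    Kernel (S × A) (S × A) :=
  M.transition ⊗ₖ Kernel.prodMkLeft (S × A) (π.at θ)

instance (M : MDP S A) (π : Policy d S A) (θ : Param d) : IsMarkovKernel (stepKernel M π θ) := by
  unfold stepKernel; infer_instance

/-- Law of `(s_{n+1}, a_{n+1})` given the history `(s₀, a₀, …, s_n, a_n)` under `π_θ`. -/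
noncomputable def histKernel (M : MDP S A) (π : Policy d S A) (θ : Param d) (n : ℕ) :
    Kernel ((i : Finset.Iic n) → S × A) (S × A) :=
  (stepKernel M π θ).comap (fun h => h ⟨n, Finset.mem_Iic.2 le_rfl⟩) (by fun_prop)

instance (M : MDP S A) (π : Policy d S A) (θ : Param d) (n : ℕ) :
    IsMarkovKernel (histKernel M π θ n) := by
  unfold histKernel; infer_instance

/-- The law `p(· ∣ θ)` of a trajectory: `s₀ ∼ ρ`, `a_t ∼ π_θ(· ∣ s_t)`,
`s_{t+1} ∼ P(· ∣ s_t, a_t)`. -/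
noncomputable def trajLaw (M : MDP S A) (π : Policy d S A) (θ : Param d) : Measure (Traj S A) :=
  Kernel.trajMeasure (X := fun _ => S × A) (M.init ⊗ₘ π.at θ) (histKernel M π θ)

instance (M : MDP S A) (π : Policy d S A) (θ : Param d) :
    IsProbabilityMeasure (trajLaw M π θ) := by
  unfold trajLaw; infer_instance

/-- The total discounted reward of a trajectory. -/
noncomputable def totalReward (M : MDP S A) (τ : Traj S A) : ℝ :=
  ∑' t, M.γ ^ t * M.reward (τ t)

/-- The expected return `J(θ)`. -/
noncomputable def J (M : MDP S A) (π : Policy d S A) (θ : Param d) : ℝ :=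
  ∫ τ, totalReward M τ ∂(trajLaw M π θ)

/-- The optimal expected return `J^* = sup_θ J(θ)`. -/
noncomputable def Jstar (M : MDP S A) (π : Policy d S A) : ℝ := ⨆ θ, J M π θ

/-! The stochastic gradient estimators. -/

/-- The two truncated gradient estimators. -/
inductive Estimator
  | REINFORCE
  | GPOMDP

/-- The gradient estimator with horizon `H` based on a single trajectory. -/
noncomputable def gradEst (M : MDP S A) (π : Policy d S A) (H : ℕ) :
    Estimator → Param d → Traj S A → Param d
  | .REINFORCE, θ, τ =>
      (∑ t ∈ Finset.range H, M.γ ^ t * M.reward (τ t)) • ∑ t ∈ Finset.range H, π.score θ (τ t)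
  | .GPOMDP, θ, τ =>
      ∑ t ∈ Finset.range H,
        (M.γ ^ t * M.reward (τ t)) • ∑ k ∈ Finset.range (t + 1), π.score θ (τ k)

/-- The mini-batch gradient estimator with `m` trajectories of horizon `H`. -/
noncomputable def batchGradEst (M : MDP S A) (π : Policy d S A) (e : Estimator) (H m : ℕ)
    (θ : Param d) (τ : Fin m → Traj S A) : Param d :=
  (1 / (m : ℝ)) • ∑ i, gradEst M π H e θ (τ i)

/-! Measurability facts that make the policy gradient iteration a Markov chain. -/

theorem measurable_gradEst (M : MDP S A) (π : Policy d S A) (e : Estimator) (H : ℕ) :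
    Measurable fun p : Param d × Traj S A => gradEst M π H e p.1 p.2 := by
  have hr : ∀ t : ℕ, Measurable fun p : Param d × Traj S A => M.γ ^ t * M.reward (p.2 t) :=
    fun t => (M.measurable_reward.comp (by fun_prop)).const_mul _
  have hs : ∀ t : ℕ, Measurable fun p : Param d × Traj S A => π.score p.1 (p.2 t) :=
    fun t => π.measurable_score.comp (f := fun p : Param d × Traj S A => (p.1, p.2 t))
      (by fun_prop)
  cases e with
  | REINFORCE =>
    exact (Finset.measurable_sum _ fun t _ => hr t).smul (Finset.measurable_sum _ fun t _ => hs t)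
  | GPOMDP =>
    exact Finset.measurable_sum _ fun t _ =>
      (hr t).smul (Finset.measurable_sum _ fun k _ => hs k)

theorem measurable_batchGradEst (M : MDP S A) (π : Policy d S A) (e : Estimator) (H m : ℕ) :
    Measurable fun p : Param d × (Fin m → Traj S A) => batchGradEst M π e H m p.1 p.2 := by
  have h : Measurable fun p : Param d × (Fin m → Traj S A) =>
      ∑ i, gradEst M π H e p.1 (p.2 i) :=
    Finset.measurable_sum _ fun i _ => (measurable_gradEst M π e H).comp
      (f := fun p : Param d × (Fin m → Traj S A) => (p.1, p.2 i)) (by fun_prop)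
  exact h.const_smul (1 / (m : ℝ))

theorem measurable_compProd_stepKernel (M : MDP S A) (π : Policy d S A) {X : Type*}
    [MeasurableSpace X] (μ : Param d → Measure X) [∀ θ, IsProbabilityMeasure (μ θ)]
    (hμ : Measurable μ) (f : X → S × A) (hf : Measurable f) :
    Measurable fun θ => μ θ ⊗ₘ (stepKernel M π θ).comap f hf := by
  let κ : Kernel (Param d) X := ⟨μ, hμ⟩
  have : IsMarkovKernel κ := ⟨fun θ => inferInstanceAs (IsProbabilityMeasure (μ θ))⟩
  let η : Kernel (Param d × X) (S × A) :=
    (M.transition.comap (fun p : Param d × X => f p.2) (by fun_prop)) ⊗ₖ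
      (π.kernel.comap (fun q : (Param d × X) × S => (q.1.1, q.2)) (by fun_prop))
  have h : (fun θ => μ θ ⊗ₘ (stepKernel M π θ).comap f hf) = fun θ => (κ ⊗ₖ η) θ := by
    funext θ
    rw [Kernel.compProd_apply_eq_compProd_sectR]
    change μ θ ⊗ₘ _ = μ θ ⊗ₘ _
    congr 1
    ext x s hs
    rw [Kernel.comap_apply, Kernel.sectR_apply, stepKernel, Kernel.compProd_apply hs,
      Kernel.compProd_apply hs]
    rfl
  rw [h]
  exact (κ ⊗ₖ η).measurable

theorem measurable_map_frestrictLe_trajLaw (M : MDP S A) (π : Policy d S A) (n : ℕ) :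
    Measurable fun θ => (trajLaw M π θ).map (Preorder.frestrictLe (π := fun _ => S × A) n) := by
  induction n with
  | zero =>
    have h0 : ∀ θ, (trajLaw M π θ).map (Preorder.frestrictLe (π := fun _ => S × A) 0) =
        (M.init ⊗ₘ π.at θ).map
          (MeasurableEquiv.piUnique (fun _ : Finset.Iic (0 : ℕ) => S × A)).symm := by
      intro θ
      rw [trajLaw, Kernel.trajMeasure, Measure.map_comp _ _ (by fun_prop),
        Kernel.traj_map_frestrictLe, Kernel.partialTraj_self, Measure.id_comp]
    simp_rw [h0]
    refine (Measure.measurable_map _ (MeasurableEquiv.measurable _)).comp ?_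
    let κ : Kernel (Param d) S := Kernel.const _ M.init
    have h : (fun θ => M.init ⊗ₘ π.at θ) = fun θ => (κ ⊗ₖ π.kernel) θ := by
      funext θ
      rw [Kernel.compProd_apply_eq_compProd_sectR]
      rfl
    rw [h]
    exact (κ ⊗ₖ π.kernel).measurable
  | succ n ih =>
    let g : ((i : Finset.Iic n) → S × A) × (S × A) → ((i : Finset.Iic (n + 1)) → S × A) :=
      fun p i => if h : i.1 ≤ n then p.1 ⟨i.1, Finset.mem_Iic.2 h⟩ else p.2
    have hg : Measurable g := by
      refine measurable_pi_iff.2 fun i => ?_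
      by_cases h : i.1 ≤ n
      · simp only [g, h, dif_pos]
        fun_prop
      · simp only [g, h, dif_neg, not_false_eq_true]
        fun_prop
    have h1 : ∀ θ, (trajLaw M π θ).map (Preorder.frestrictLe (π := fun _ => S × A) (n + 1)) =
        (((trajLaw M π θ).map (Preorder.frestrictLe (π := fun _ => S × A) n)) ⊗ₘ
          histKernel M π θ n).map g := by
      intro θ
      rw [trajLaw, Kernel.map_frestrictLe_trajMeasure_compProd_eq_map_trajMeasure,
        Measure.map_map hg (by fun_prop)]
      congr 1
      funext x i
      by_cases h : i.1 ≤ n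
      · simp [g, h]
      · have : i.1 = n + 1 := le_antisymm (Finset.mem_Iic.1 i.2) (by omega)
        simp [g, this]
    simp_rw [h1]
    have : ∀ θ, IsProbabilityMeasure
        ((trajLaw M π θ).map (Preorder.frestrictLe (π := fun _ => S × A) n)) :=
      fun θ => Measure.isProbabilityMeasure_map (by fun_prop)
    exact (Measure.measurable_map _ hg).comp
      (measurable_compProd_stepKernel M π _ ih _ (by fun_prop))

theorem measurable_trajLaw (M : MDP S A) (π : Policy d S A) : Measurable (trajLaw M π) := by
  refine .measure_of_isPiSystem_of_isProbabilityMeasure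
    (S := measurableCylinders fun _ : ℕ => S × A)
    generateFrom_measurableCylinders.symm isPiSystem_measurableCylinders ?_
  intro t ht
  obtain ⟨N, B, hB, rfl⟩ : ∃ N B, MeasurableSet B ∧
      t = cylinder (α := fun _ : ℕ => S × A) (Finset.Iic N) B := by
    simpa [measurableCylinders_nat] using ht
  have h : ∀ θ, trajLaw M π θ (cylinder (α := fun _ : ℕ => S × A) (Finset.Iic N) B) =
      (trajLaw M π θ).map (Preorder.frestrictLe (π := fun _ => S × A) N) B := by
    intro θ
    rw [Measure.map_apply (by fun_prop) hB]
    rfl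
  simp_rw [h]
  exact (Measure.measurable_coe hB).comp (measurable_map_frestrictLe_trajLaw M π N)

/-- The law of a trajectory as a kernel in the parameter `θ`. -/
noncomputable def trajKernel (M : MDP S A) (π : Policy d S A) : Kernel (Param d) (Traj S A) :=
  ⟨trajLaw M π, measurable_trajLaw M π⟩

/-- The law of `m` independent trajectories sampled from `p(· ∣ θ)`. -/
noncomputable def batchLaw (M : MDP S A) (π : Policy d S A) (m : ℕ) (θ : Param d) :
    Measure (Fin m → Traj S A) :=
  Measure.pi fun _ => trajLaw M π θ

instance (M : MDP S A) (π : Policy d S A) (m : ℕ) (θ : Param d) :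
    IsProbabilityMeasure (batchLaw M π m θ) := by
  unfold batchLaw; infer_instance

theorem measurable_batchLaw (M : MDP S A) (π : Policy d S A) (m : ℕ) :
    Measurable (batchLaw M π m) := by
  refine .measure_of_isPiSystem_of_isProbabilityMeasure generateFrom_pi.symm isPiSystem_pi ?_
  rintro _ ⟨s, hs, rfl⟩
  simp only [batchLaw, Measure.pi_pi]
  refine Finset.measurable_prod _ fun i _ => ?_
  have hi : MeasurableSet (s i) := hs i (Set.mem_univ i)
  exact (Measure.measurable_coe hi).comp (measurable_trajLaw M π)

/-- The law of `m` independent trajectories as a kernel in `θ`. -/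
noncomputable def batchKernel (M : MDP S A) (π : Policy d S A) (m : ℕ) :
    Kernel (Param d) (Fin m → Traj S A) :=
  ⟨batchLaw M π m, measurable_batchLaw M π m⟩

instance (M : MDP S A) (π : Policy d S A) (m : ℕ) : IsMarkovKernel (batchKernel M π m) :=
  ⟨fun θ => inferInstanceAs (IsProbabilityMeasure (batchLaw M π m θ))⟩

/-! Vanilla policy gradient. -/

/-- One update: the law of `θ + η * (batch gradient estimate at θ)`, where the batch consists of `m`
independent trajectories sampled from `p(· ∣ θ)`. -/
noncomputable def pgKernel (M : MDP S A) (π : Policy d S A) (e : Estimator) (H m : ℕ) (η : ℝ) :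
    Kernel (Param d) (Param d) :=
  (Kernel.id ×ₖ batchKernel M π m).map fun p => p.1 + η • batchGradEst M π e H m p.1 p.2

instance (M : MDP S A) (π : Policy d S A) (e : Estimator) (H m : ℕ) (η : ℝ) :
    IsMarkovKernel (pgKernel M π e H m η) := by
  unfold pgKernel
  exact Kernel.IsMarkovKernel.map _
    (measurable_fst.add ((measurable_batchGradEst M π e H m).const_smul η))

/-- The update kernel, as a function of the history of iterates. -/
noncomputable def pgHistKernel (M : MDP S A) (π : Policy d S A) (e : Estimator) (H m : ℕ) (η : ℝ)
    (n : ℕ) : Kernel ((i : Finset.Iic n) → Param d) (Param d) :=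
  (pgKernel M π e H m η).comap (fun h => h ⟨n, Finset.mem_Iic.2 le_rfl⟩) (by fun_prop)

instance (M : MDP S A) (π : Policy d S A) (e : Estimator) (H m : ℕ) (η : ℝ) (n : ℕ) :
    IsMarkovKernel (pgHistKernel M π e H m η n) := by
  unfold pgHistKernel; infer_instance

/-- The law of the sequence of iterates `(θ_t)_{t ≥ 0}` started at `θ₀`. -/
noncomputable def pgLaw (M : MDP S A) (π : Policy d S A) (e : Estimator) (H m : ℕ) (η : ℝ)
    (θ₀ : Param d) : Measure (ℕ → Param d) :=
  Kernel.trajMeasure (X := fun _ => Param d) (Measure.dirac θ₀) (pgHistKernel M π e H m η)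

/-- `E ‖∇J(θ_U)‖²`, where `U` is uniform on `{0, …, T - 1}` and independent of the iterates. -/
noncomputable def expSqGrad (M : MDP S A) (π : Policy d S A) (e : Estimator) (H m : ℕ) (η : ℝ)
    (θ₀ : Param d) (T : ℕ) : ℝ≥0∞ :=
  ∫⁻ p : ℕ × (ℕ → Param d), ‖gradient (J M π) (p.2 p.1)‖ₑ ^ 2
    ∂((uniformOn (Set.Iio T)).prod (pgLaw M π e H m η θ₀))

/-! The constants. -/

/-- The initial suboptimality gap `δ₀`. -/
noncomputable def gap (M : MDP S A) (π : Policy d S A) (θ₀ : Param d) : ℝ :=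
  Jstar M π - J M π θ₀

/-- The smoothness constant `L`. -/
noncomputable def smoothL (M : MDP S A) (G F : ℝ) : ℝ :=
  M.Rmax / (1 - M.γ) ^ 2 * (G ^ 2 + F)

/-- The variance constant `ν`. -/
noncomputable def varNu (M : MDP S A) (G : ℝ) (H : ℕ) : Estimator → ℝ
  | .REINFORCE => H * G ^ 2 * M.Rmax ^ 2 / (1 - M.γ) ^ 2
  | .GPOMDP => G ^ 2 * M.Rmax ^ 2 / (1 - M.γ) ^ 3

/-- The truncation constant `D'`. -/
noncomputable def truncD' (M : MDP S A) (G : ℝ) (H : ℕ) : ℝ :=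
  G * M.Rmax / (1 - M.γ) * √(1 / (1 - M.γ) + H)

/-- The truncation constant `D`. -/
noncomputable def truncD (M : MDP S A) (G : ℝ) (H : ℕ) : ℝ :=
  truncD' M G H * G * M.Rmax / (1 - M.γ) ^ (3 / 2 : ℝ)

/-- The power of `log (1/ε)` in the total sample complexity. -/
def logPower : Estimator → ℕ
  | .REINFORCE => 2
  | .GPOMDP => 1

end

end PolicyGradient

namespace PolicyGradient

/-! Differentiation under the integral sign for families of densities. -/

/-! The hypotheses control the score and the Hessian only in mean, for each parameter separately, so
there is no dominating function under which to differentiate expectations. The substitute is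
calculus in L¹. If `p θ` are densities with scores `s θ`, then `∇p = p s`, and the derivative of `p
s` is `p (∇s + s sᵀ)`, whose L¹ norm is at most `a + b`, where `a` bounds the mean of `‖s‖²` and `b`
that of `‖∇s‖`. Integrating along segments and exchanging integrals by Tonelli, `θ ↦ p θ • s θ` is
`(a + b)`-Lipschitz into L¹ and the first-order remainder of `p` is quadratically small in L¹. Hence
every bounded `f` has `∇ ∫ f p = ∫ f p s`, with Lipschitz gradient
(`IsSmoothFamily.hasGradientAt_integral`, `IsSmoothFamily.norm_integral_score_sub_le`).

This is applied to the first `n` steps of a trajectory. Relative to the law at parameter `0` the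
density is a product of policy ratios, since the transitions cancel. The one-step scores are
martingale differences, so the second moment of their sum is at most `n G²`, while the Hessians add
up to `n F`. The expected reward at time `t` thus has a gradient of size `O(√(t+1))` and Lipschitz
constant `O(t+1)`. Discounted summation differentiates `J` term by term and gives `L` from `∑ γ^t
(t+1)`, and the truncation bias `D' γ^H` from the tail of `∑ γ^t √(t+1)`.

Both estimators have the gradient `g` of the truncated return as mean, and second moment at most
`ν`. A batch of `m` has second moment at most `ν/m + (1 - 1/m) ‖g‖²`. The ascent lemma for
`L`-smooth functions then gives an expected gain of at least `η ⟨∇J, g⟩ - L η²/2 (ν/m + (1 - 1/m)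
‖g‖²)` per step. The `‖g‖²` part of the loss is absorbed into the gain, which leaves the factor `2 -
y`; replacing `g` by `∇J` costs the `D` and `D'` terms. Telescoping along the Markov chain of
iterates gives the explicit bound.

For the parameters, `m ≤ 2ν/ε²` means `L η ≤ 1`, so `y ≤ 1`; the initial gap and the noise then
contribute at most `ε²/2` each, and `γ^H` beats the linear growth in `H` of the truncation
constants. -/

/-- The derivative need not be continuous: the fundamental theorem of calculus only needs it to
exist everywhere and be integrable, and when it is not integrable the right-hand side is infinite.
-/
theorem enorm_sub_le_lintegral_of_hasDerivAt {E : Type*} [NormedAddCommGroup E] [NormedSpace ℝ E]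
    [CompleteSpace E] [SecondCountableTopology E] {f f' : ℝ → E}
    (hf : ∀ u, HasDerivAt f (f' u) u) :
    ‖f 1 - f 0‖ₑ ≤ ∫⁻ u in Set.Ioc (0 : ℝ) 1, ‖f' u‖ₑ := by
  borelize E
  by_cases h : ∫⁻ u in Set.Ioc (0 : ℝ) 1, ‖f' u‖ₑ = ∞
  · rw [h]; exact le_top
  have hm : Measurable f' := by
    have : f' = deriv f := funext fun u => (hf u).deriv.symm
    rw [this]
    exact measurable_deriv f
  have hi : IntervalIntegrable f' volume 0 1 := by
    rw [intervalIntegrable_iff_integrableOn_Ioc_of_le zero_le_one]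
    exact ⟨hm.aestronglyMeasurable, lt_top_iff_ne_top.2 h⟩
  rw [← intervalIntegral.integral_eq_sub_of_hasDerivAt (fun u _ => hf u) hi,
    intervalIntegral.integral_of_le zero_le_one]
  exact enorm_integral_le_lintegral_enorm _

/-- The fundamental theorem of calculus for each `x`, followed by Tonelli. Only the L¹ norms of the
derivatives are bounded uniformly in `u`; no integrable majorant over all `u` is needed. -/
theorem lintegral_enorm_sub_le_of_hasDerivAt {X E : Type*} [MeasurableSpace X] {μ : Measure X}
    [SFinite μ] [NormedAddCommGroup E] [NormedSpace ℝ E] [CompleteSpace E]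
    [SecondCountableTopology E] [MeasurableSpace E] [BorelSpace E] {q q' : ℝ → X → E}
    (hq : Measurable fun z : ℝ × X => q z.1 z.2) (hd : ∀ u x, HasDerivAt (fun u => q u x) (q' u x) u)
    {B : ℝ≥0∞} (hB : ∀ u ∈ Set.Icc (0 : ℝ) 1, ∫⁻ x, ‖q' u x‖ₑ ∂μ ≤ B) :
    ∫⁻ x, ‖q 1 x - q 0 x‖ₑ ∂μ ≤ B := by
  -- Tonelli needs joint measurability of the derivative, which is a pointwise limit of jointly
  -- measurable difference quotients.
  have hm : Measurable fun z : ℝ × X => q' z.1 z.2 := by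
    have hn : ∀ n : ℕ, Measurable fun z : ℝ × X =>
        (n : ℝ) • (q (z.1 + (n : ℝ)⁻¹ • 1) z.2 - q z.1 z.2) := fun n =>
      ((hq.comp (f := fun z : ℝ × X => (z.1 + (n : ℝ)⁻¹ • 1, z.2)) (by fun_prop)).sub
        hq).const_smul (n : ℝ)
    refine measurable_of_tendsto_metrizable hn (tendsto_pi_nhds.2 fun z => ?_)
    have h := ((hd z.1 z.2).hasFDerivAt.lim_real 1).comp (tendsto_natCast_atTop_atTop (R := ℝ))
    simpa [Function.comp_def] using h
  calc ∫⁻ x, ‖q 1 x - q 0 x‖ₑ ∂μ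
      ≤ ∫⁻ x, (∫⁻ u in Set.Ioc (0 : ℝ) 1, ‖q' u x‖ₑ) ∂μ :=
        lintegral_mono fun x => enorm_sub_le_lintegral_of_hasDerivAt fun u => hd u x
    _ = ∫⁻ u in Set.Ioc (0 : ℝ) 1, ∫⁻ x, ‖q' u x‖ₑ ∂μ :=
        lintegral_lintegral_swap
          (hm.comp measurable_swap).enorm.aemeasurable
    _ ≤ ∫⁻ _ in Set.Ioc (0 : ℝ) 1, B :=
        setLIntegral_mono measurable_const fun u hu => hB u ⟨hu.1.le, hu.2⟩
    _ = B := by simp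

theorem hasDerivAt_add_smul {E : Type*} [NormedAddCommGroup E] [NormedSpace ℝ E] (x v : E)
    (u : ℝ) : HasDerivAt (fun u : ℝ => x + u • v) v u := by
  have h := ((hasDerivAt_id u).smul_const v).const_add x
  rwa [one_smul] at h

theorem _root_.HasGradientAt.comp_hasDerivAt {E : Type*} [NormedAddCommGroup E]
    [InnerProductSpace ℝ E] [CompleteSpace E] {g : E → ℝ} {g' : E} {c : ℝ → E} {w : E} {u : ℝ}
    (hg : HasGradientAt g g' (c u)) (hc : HasDerivAt c w u) :
    HasDerivAt (fun u => g (c u)) (inner ℝ g' w) u :=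
  hg.hasFDerivAt.comp_hasDerivAt u hc

/-- A smooth family of probability densities `p θ` with scores `s θ = ∇ log p θ`, whose second
moments are at most `a` and whose derivatives are at most `b` in mean. -/
structure IsSmoothFamily {d : ℕ} {X : Type*} [MeasurableSpace X] (μ : Measure X)
    (p : Param d → X → ℝ) (s : Param d → X → Param d) (a b : ℝ) : Prop where
  measurable_density : Measurable fun z : Param d × X => p z.1 z.2
  measurable_score : Measurable fun z : Param d × X => s z.1 z.2
  density_nonneg : ∀ θ x, 0 ≤ p θ x
  hasGradientAt_density : ∀ θ x, HasGradientAt (fun θ => p θ x) (p θ x • s θ x) θ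
  differentiable_score : ∀ x, Differentiable ℝ fun θ => s θ x
  lintegral_density : ∀ θ, ∫⁻ x, ENNReal.ofReal (p θ x) ∂μ = 1
  a_nonneg : 0 ≤ a
  b_nonneg : 0 ≤ b
  score_sq_le : ∀ θ, ∫⁻ x, ENNReal.ofReal (p θ x) * ‖s θ x‖ₑ ^ 2 ∂μ ≤ ENNReal.ofReal a
  fderiv_score_le : ∀ θ, ∫⁻ x, ENNReal.ofReal (p θ x) * ‖fderiv ℝ (fun θ => s θ x) θ‖ₑ ∂μ ≤
    ENNReal.ofReal b

namespace IsSmoothFamily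

variable {d : ℕ} {X : Type*} [MeasurableSpace X] {μ : Measure X}
  {p : Param d → X → ℝ} {s : Param d → X → Param d} {a b : ℝ}

theorem measurable_density_at (h : IsSmoothFamily μ p s a b) (θ : Param d) : Measurable (p θ) :=
  h.measurable_density.comp measurable_prodMk_left

theorem measurable_score_at (h : IsSmoothFamily μ p s a b) (θ : Param d) : Measurable (s θ) :=
  h.measurable_score.comp measurable_prodMk_left

theorem integrable_density (h : IsSmoothFamily μ p s a b) (θ : Param d) : Integrable (p θ) μ := by
  refine ⟨(h.measurable_density_at θ).aestronglyMeasurable, ?_⟩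
  rw [hasFiniteIntegral_iff_ofReal (ae_of_all _ (h.density_nonneg θ)), h.lintegral_density]
  exact ENNReal.one_lt_top

theorem integrable_density_smul_score (h : IsSmoothFamily μ p s a b) (θ : Param d) :
    Integrable (fun x => p θ x • s θ x) μ := by
  have hp := h.measurable_density_at θ
  have hs := h.measurable_score_at θ
  refine ⟨(hp.smul hs).aestronglyMeasurable, ?_⟩
  -- Uses `t ≤ 1 + t²` to bound the first moment of the score by its second moment.
  calc ∫⁻ x, ‖p θ x • s θ x‖ₑ ∂μ
      ≤ ∫⁻ x, (ENNReal.ofReal (p θ x) + ENNReal.ofReal (p θ x) * ‖s θ x‖ₑ ^ 2) ∂μ := by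
        refine lintegral_mono fun x => ?_
        rw [enorm_smul, Real.enorm_of_nonneg (h.density_nonneg θ x)]
        nth_rewrite 2 [← mul_one (ENNReal.ofReal (p θ x))]
        rw [← mul_add]
        gcongr
        rcases le_total (‖s θ x‖ₑ) 1 with h1 | h1
        · exact h1.trans le_self_add
        · exact (le_self_pow₀ h1 two_ne_zero).trans le_add_self
    _ = 1 + ∫⁻ x, ENNReal.ofReal (p θ x) * ‖s θ x‖ₑ ^ 2 ∂μ := by
        rw [lintegral_add_left hp.ennreal_ofReal, h.lintegral_density]
    _ < ∞ := ENNReal.add_lt_top.2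
        ⟨ENNReal.one_lt_top, (h.score_sq_le θ).trans_lt ENNReal.ofReal_lt_top⟩

/-- Along the segment in direction `w`, the derivative of `p s` is `p (∇s w) + p ⟨s, w⟩ s`. The
first term costs `b ‖w‖` in mean, the second `a ‖w‖`. -/
theorem lintegral_density_smul_score_sub_le [SFinite μ] (h : IsSmoothFamily μ p s a b)
    (θ θ' : Param d) :
    ∫⁻ x, ‖p θ' x • s θ' x - p θ x • s θ x‖ₑ ∂μ ≤ ENNReal.ofReal (a + b) * ‖θ' - θ‖ₑ := by
  set w : Param d := θ' - θ with hw
  let c : ℝ → Param d := fun u => θ + u • w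
  have hc : ∀ u, HasDerivAt c w u := hasDerivAt_add_smul θ w
  have hcm : Measurable c := by fun_prop
  let q : ℝ → X → Param d := fun u x => p (c u) x • s (c u) x
  let q' : ℝ → X → Param d := fun u x =>
    p (c u) x • fderiv ℝ (fun θ => s θ x) (c u) w +
      (inner ℝ (p (c u) x • s (c u) x) w : ℝ) • s (c u) x
  have hq : Measurable fun z : ℝ × X => q z.1 z.2 := by
    have hz : Measurable fun z : ℝ × X => (c z.1, z.2) := by fun_prop
    exact (h.measurable_density.comp hz).smul (h.measurable_score.comp hz)
  have hd : ∀ u x, HasDerivAt (fun u => q u x) (q' u x) u := by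
    intro u x
    have h1 : HasDerivAt (fun u => p (c u) x) (inner ℝ (p (c u) x • s (c u) x) w) u :=
      (h.hasGradientAt_density (c u) x).comp_hasDerivAt (hc u)
    have h2 : HasDerivAt (fun u => s (c u) x) (fderiv ℝ (fun θ => s θ x) (c u) w) u :=
      (h.differentiable_score x (c u)).hasFDerivAt.comp_hasDerivAt u (hc u)
    exact h1.smul h2
  have hB : ∀ u ∈ Set.Icc (0 : ℝ) 1,
      ∫⁻ x, ‖q' u x‖ₑ ∂μ ≤ ENNReal.ofReal (a + b) * ‖w‖ₑ := by
    intro u _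
    calc ∫⁻ x, ‖q' u x‖ₑ ∂μ
        ≤ ∫⁻ x, (ENNReal.ofReal (p (c u) x) * ‖s (c u) x‖ₑ ^ 2 +
            ENNReal.ofReal (p (c u) x) * ‖fderiv ℝ (fun θ => s θ x) (c u)‖ₑ) * ‖w‖ₑ ∂μ := by
          refine lintegral_mono fun x => ?_
          have hp0 := Real.enorm_of_nonneg (h.density_nonneg (c u) x)
          have e1 : ‖p (c u) x • fderiv ℝ (fun θ => s θ x) (c u) w‖ₑ ≤
              ENNReal.ofReal (p (c u) x) * ‖fderiv ℝ (fun θ => s θ x) (c u)‖ₑ * ‖w‖ₑ := by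
            rw [enorm_smul, hp0, mul_assoc]
            gcongr
            exact ContinuousLinearMap.le_opENorm _ _
          have e2 : ‖(inner ℝ (p (c u) x • s (c u) x) w : ℝ) • s (c u) x‖ₑ ≤
              ENNReal.ofReal (p (c u) x) * ‖s (c u) x‖ₑ ^ 2 * ‖w‖ₑ := by
            rw [real_inner_smul_left, enorm_smul, enorm_mul, hp0]
            have : ‖(inner ℝ (s (c u) x) w : ℝ)‖ₑ ≤ ‖s (c u) x‖ₑ * ‖w‖ₑ := by
              rw [← ofReal_norm, ← ofReal_norm, ← ofReal_norm,
                ← ENNReal.ofReal_mul (norm_nonneg _)]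
              exact ENNReal.ofReal_le_ofReal (norm_inner_le_norm _ _)
            calc _ ≤ ENNReal.ofReal (p (c u) x) * (‖s (c u) x‖ₑ * ‖w‖ₑ) * ‖s (c u) x‖ₑ := by
                  gcongr
              _ = _ := by ring
          calc _ ≤ _ := enorm_add_le _ _
            _ ≤ _ := add_le_add e1 e2
            _ = _ := by ring
      _ = (∫⁻ x, (ENNReal.ofReal (p (c u) x) * ‖s (c u) x‖ₑ ^ 2 +
            ENNReal.ofReal (p (c u) x) * ‖fderiv ℝ (fun θ => s θ x) (c u)‖ₑ) ∂μ) * ‖w‖ₑ :=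
          lintegral_mul_const' _ _ enorm_ne_top
      _ ≤ ENNReal.ofReal (a + b) * ‖w‖ₑ := by
          gcongr
          have hm : Measurable fun x => ENNReal.ofReal (p (c u) x) * ‖s (c u) x‖ₑ ^ 2 :=
            (h.measurable_density_at _).ennreal_ofReal.mul
              ((h.measurable_score_at _).enorm.pow_const 2)
          rw [lintegral_add_left hm, ENNReal.ofReal_add h.a_nonneg h.b_nonneg]
          exact add_le_add (h.score_sq_le _) (h.fderiv_score_le _)
  have := lintegral_enorm_sub_le_of_hasDerivAt (μ := μ) hq hd hB
  simpa [q, c, hw] using this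

/-- One more integration of the L¹ Lipschitz bound: the derivative of the remainder at `u` is the
increment of `p s` over `u • w`, paired with `w`. Estimating `u ≤ 1` loses a factor `1/2`, which is
irrelevant for differentiability. -/
theorem lintegral_density_sub_linear_le [SFinite μ] (h : IsSmoothFamily μ p s a b)
    (θ θ' : Param d) :
    ∫⁻ x, ‖p θ' x - p θ x - inner ℝ (p θ x • s θ x) (θ' - θ)‖ₑ ∂μ ≤
      ENNReal.ofReal (a + b) * ‖θ' - θ‖ₑ ^ 2 := by
  set w : Param d := θ' - θ with hw
  let c : ℝ → Param d := fun u => θ + u • w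
  have hc : ∀ u, HasDerivAt c w u := hasDerivAt_add_smul θ w
  have hcm : Measurable c := by fun_prop
  let q : ℝ → X → ℝ := fun u x => p (c u) x - u * inner ℝ (p θ x • s θ x) w
  let q' : ℝ → X → ℝ := fun u x => inner ℝ (p (c u) x • s (c u) x - p θ x • s θ x) w
  have hq : Measurable fun z : ℝ × X => q z.1 z.2 := by
    have hz : Measurable fun z : ℝ × X => (c z.1, z.2) := by fun_prop
    have h1 : Measurable fun z : ℝ × X => p θ z.2 • s θ z.2 :=
      ((h.measurable_density_at θ).smul (h.measurable_score_at θ)).comp measurable_snd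
    exact (h.measurable_density.comp hz).sub (measurable_fst.mul (h1.inner measurable_const))
  have hd : ∀ u x, HasDerivAt (fun u => q u x) (q' u x) u := by
    intro u x
    have h1 : HasDerivAt (fun u => p (c u) x) (inner ℝ (p (c u) x • s (c u) x) w) u :=
      (h.hasGradientAt_density (c u) x).comp_hasDerivAt (hc u)
    have h2 := h1.sub ((hasDerivAt_id u).mul_const (inner ℝ (p θ x • s θ x) w : ℝ))
    rw [one_mul, ← inner_sub_left] at h2
    exact h2
  have hB : ∀ u ∈ Set.Icc (0 : ℝ) 1,
      ∫⁻ x, ‖q' u x‖ₑ ∂μ ≤ ENNReal.ofReal (a + b) * ‖w‖ₑ ^ 2 := by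
    intro u hu
    calc ∫⁻ x, ‖q' u x‖ₑ ∂μ
        ≤ ∫⁻ x, ‖p (c u) x • s (c u) x - p θ x • s θ x‖ₑ * ‖w‖ₑ ∂μ := by
          refine lintegral_mono fun x => ?_
          rw [← ofReal_norm, ← ofReal_norm, ← ofReal_norm, ← ENNReal.ofReal_mul (norm_nonneg _)]
          exact ENNReal.ofReal_le_ofReal (norm_inner_le_norm _ _)
      _ = (∫⁻ x, ‖p (c u) x • s (c u) x - p θ x • s θ x‖ₑ ∂μ) * ‖w‖ₑ :=
          lintegral_mul_const' _ _ enorm_ne_top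
      _ ≤ ENNReal.ofReal (a + b) * ‖c u - θ‖ₑ * ‖w‖ₑ := by
          gcongr
          exact h.lintegral_density_smul_score_sub_le θ (c u)
      _ ≤ ENNReal.ofReal (a + b) * ‖w‖ₑ * ‖w‖ₑ := by
          gcongr
          have : c u - θ = u • w := by simp [c]
          rw [this, enorm_smul, Real.enorm_of_nonneg hu.1]
          refine mul_le_of_le_one_left' ?_
          simpa using hu.2
      _ = _ := by ring
  have := lintegral_enorm_sub_le_of_hasDerivAt (μ := μ) hq hd hB
  refine (lintegral_congr fun x => ?_).trans_le this
  congr 1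
  simp [q, c, hw]
  ring

variable {f : X → ℝ} {K : ℝ}

theorem integrable_mul_density (h : IsSmoothFamily μ p s a b) (hf : Measurable f)
    (hK : ∀ x, |f x| ≤ K) (θ : Param d) : Integrable (fun x => f x * p θ x) μ :=
  (h.integrable_density θ).bdd_mul hf.aestronglyMeasurable (ae_of_all _ hK)

theorem integrable_smul_density_smul_score (h : IsSmoothFamily μ p s a b) (hf : Measurable f)
    (hK : ∀ x, |f x| ≤ K) (θ : Param d) : Integrable (fun x => f x • p θ x • s θ x) μ :=
  (h.integrable_density_smul_score θ).bdd_smul (𝕜 := ℝ) K hf.aestronglyMeasurable (ae_of_all _ hK)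

theorem norm_integral_smul_le {E : Type*} [NormedAddCommGroup E] [NormedSpace ℝ E] {g : X → E}
    {c : ℝ} (hc : 0 ≤ c) (hK0 : 0 ≤ K) (hK : ∀ x, |f x| ≤ K)
    (hg : ∫⁻ x, ‖g x‖ₑ ∂μ ≤ ENNReal.ofReal c) : ‖∫ x, f x • g x ∂μ‖ ≤ K * c := by
  have h1 : ‖∫ x, f x • g x ∂μ‖ₑ ≤ ENNReal.ofReal (K * c) := by
    calc ‖∫ x, f x • g x ∂μ‖ₑ ≤ ∫⁻ x, ‖f x • g x‖ₑ ∂μ := enorm_integral_le_lintegral_enorm _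
      _ ≤ ∫⁻ x, ENNReal.ofReal K * ‖g x‖ₑ ∂μ := by
          refine lintegral_mono fun x => ?_
          rw [enorm_smul]
          gcongr
          rw [← ofReal_norm]
          exact ENNReal.ofReal_le_ofReal (hK x)
      _ = ENNReal.ofReal K * ∫⁻ x, ‖g x‖ₑ ∂μ := lintegral_const_mul' _ _ ENNReal.ofReal_ne_top
      _ ≤ ENNReal.ofReal K * ENNReal.ofReal c := by gcongr
      _ = _ := (ENNReal.ofReal_mul hK0).symm
  rw [← ofReal_norm] at h1
  exact (ENNReal.ofReal_le_ofReal_iff (mul_nonneg hK0 hc)).1 h1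

theorem norm_integral_score_sub_le [SFinite μ] (h : IsSmoothFamily μ p s a b) (hf : Measurable f)
    (hK0 : 0 ≤ K) (hK : ∀ x, |f x| ≤ K) (θ θ' : Param d) :
    ‖(∫ x, f x • p θ' x • s θ' x ∂μ) - ∫ x, f x • p θ x • s θ x ∂μ‖ ≤
      K * (a + b) * ‖θ' - θ‖ := by
  have hab := add_nonneg h.a_nonneg h.b_nonneg
  rw [← integral_sub (h.integrable_smul_density_smul_score hf hK θ')
    (h.integrable_smul_density_smul_score hf hK θ)]
  simp_rw [← smul_sub]
  rw [mul_assoc]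
  refine norm_integral_smul_le (by positivity) hK0 hK ?_
  rw [ENNReal.ofReal_mul hab, ofReal_norm]
  exact h.lintegral_density_smul_score_sub_le θ θ'

/-- A bounded `f` turns the quadratic L¹ remainder of the densities into a quadratic remainder of
the integral. -/
theorem hasGradientAt_integral [SFinite μ] (h : IsSmoothFamily μ p s a b) (hf : Measurable f)
    (hK0 : 0 ≤ K) (hK : ∀ x, |f x| ≤ K) (θ : Param d) :
    HasGradientAt (fun θ => ∫ x, f x * p θ x ∂μ) (∫ x, f x • p θ x • s θ x ∂μ) θ := by
  have hab := add_nonneg h.a_nonneg h.b_nonneg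
  rw [hasGradientAt_iff_isLittleO]
  have hO : (fun θ' : Param d => (∫ x, f x * p θ' x ∂μ) - (∫ x, f x * p θ x ∂μ) -
      inner ℝ (∫ x, f x • p θ x • s θ x ∂μ) (θ' - θ)) =O[𝓝 θ] fun θ' => ‖θ' - θ‖ ^ 2 := by
    refine Asymptotics.IsBigO.of_bound (K * (a + b)) (Eventually.of_forall fun θ' => ?_)
    have hi := h.integrable_smul_density_smul_score hf hK θ
    have e : (∫ x, f x * p θ' x ∂μ) - (∫ x, f x * p θ x ∂μ) -
        inner ℝ (∫ x, f x • p θ x • s θ x ∂μ) (θ' - θ) =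
        ∫ x, f x • (p θ' x - p θ x - inner ℝ (p θ x • s θ x) (θ' - θ)) ∂μ := by
      rw [real_inner_comm, ← integral_inner hi, ← integral_sub
        (h.integrable_mul_density hf hK θ') (h.integrable_mul_density hf hK θ),
        ← integral_sub (f := fun x => f x * p θ' x - f x * p θ x)
          ((h.integrable_mul_density hf hK θ').sub
          (h.integrable_mul_density hf hK θ)) (hi.const_inner _)]
      refine integral_congr_ae (ae_of_all _ fun x => ?_)
      simp only [smul_eq_mul, real_inner_smul_right, real_inner_smul_left, real_inner_comm (s θ x)]
      ring
    rw [e, norm_pow, norm_norm, mul_assoc]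
    refine norm_integral_smul_le (by positivity) hK0 hK ?_
    rw [ENNReal.ofReal_mul hab, ENNReal.ofReal_pow (norm_nonneg _), ofReal_norm]
    exact h.lintegral_density_sub_linear_le θ θ'
  refine hO.trans_isLittleO ?_
  have : (fun θ' : Param d => ‖θ' - θ‖ ^ 2) =o[𝓝 θ] fun θ' => θ' - θ := by
    have h1 : Tendsto (fun θ' : Param d => θ' - θ) (𝓝 θ) (𝓝 0) := by
      simpa using (continuous_id.sub continuous_const).tendsto (f := fun θ' : Param d => θ' - θ) θ
    exact (Asymptotics.isLittleO_norm_pow_id one_lt_two).comp_tendsto h1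
  exact this

end IsSmoothFamily

/-! One-step properties of the policy. -/

section

variable {d : ℕ} {S : Type u} {A : Type v} [MeasurableSpace S] [MeasurableSpace A]

namespace Policy

variable (π : Policy d S A)

theorem at_apply (θ : Param d) (s : S) :
    π.at θ s = π.ref.withDensity fun a => ENNReal.ofReal (π.density θ s a) :=
  π.kernel_apply (θ, s)

theorem density_eq_zero_iff (θ θ' : Param d) (s : S) (a : A) :
    π.density θ s a = 0 ↔ π.density θ' s a = 0 := by
  have h : ∀ θ θ', π.density θ s a = 0 → π.density θ' s a = 0 := fun θ θ' h0 => by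
    by_contra h1
    exact (π.density_pos θ' θ s a ((π.density_nonneg θ' s a).lt_of_ne' h1)).ne' h0
  exact ⟨h θ θ', h θ' θ⟩

/-- On the support this is `p = exp (log p)` differentiated. Off it, the common-support assumption
makes the density vanish for every parameter, so both sides are zero. -/
theorem hasGradientAt_density (θ : Param d) (x : S × A) :
    HasGradientAt (fun θ => π.density θ x.1 x.2) (π.density θ x.1 x.2 • π.score θ x) θ := by
  by_cases h0 : π.density θ x.1 x.2 = 0
  · have h : (fun θ => π.density θ x.1 x.2) = fun _ => 0 :=
      funext fun θ' => (π.density_eq_zero_iff θ θ' x.1 x.2).1 h0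
    rw [h, h0, zero_smul]
    exact hasGradientAt_const θ 0
  · have h1 : HasGradientAt (fun θ => Real.log (π.density θ x.1 x.2)) (π.score θ x) θ :=
      (π.differentiable_log x θ).hasGradientAt
    have h2 := h1.hasFDerivAt.exp
    have h3 : (fun θ => Real.exp (Real.log (π.density θ x.1 x.2))) =
        fun θ => π.density θ x.1 x.2 := funext fun θ' => Real.exp_log
      ((π.density_nonneg _ _ _).lt_of_ne' fun h => h0 ((π.density_eq_zero_iff _ _ _ _).1 h))
    rw [h3, Real.exp_log ((π.density_nonneg _ _ _).lt_of_ne' h0)] at h2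
    rw [hasGradientAt_iff_hasFDerivAt, map_smul]
    exact h2

theorem measurable_score_at (θ : Param d) : Measurable (π.score θ) :=
  π.measurable_score.comp measurable_prodMk_left

theorem measurable_ofReal_density (θ : Param d) (s : S) :
    Measurable fun a => ENNReal.ofReal (π.density θ s a) :=
  ((π.measurable_density θ).comp (measurable_prodMk_left (x := s))).ennreal_ofReal

theorem lintegral_at (θ : Param d) (s : S) (f : A → ℝ≥0∞) :
    ∫⁻ a, f a ∂(π.at θ s) = ∫⁻ a, ENNReal.ofReal (π.density θ s a) * f a ∂π.ref := by
  rw [at_apply, lintegral_withDensity_eq_lintegral_mul_non_measurable _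
    (π.measurable_ofReal_density θ s)
    (ae_of_all _ fun _ => ENNReal.ofReal_lt_top)]
  rfl

variable {π} {G F : ℝ}

/-- Each directional derivative is a limit of measurable difference quotients, and the operator is
rebuilt from its values on the standard basis. -/
theorem IsELS.measurable_hessLog (h : π.IsELS G F) (θ : Param d) : Measurable (π.hessLog θ) := by
  have h1 : ∀ e : Param d, Measurable fun x => π.hessLog θ x e := fun e => by
    have hn : ∀ n : ℕ, Measurable fun x : S × A =>
        (n : ℝ) • (π.score (θ + (n : ℝ)⁻¹ • e) x - π.score θ x) := fun n =>
      ((π.measurable_score_at _).sub (π.measurable_score_at _)).const_smul (n : ℝ)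
    refine measurable_of_tendsto_metrizable hn (tendsto_pi_nhds.2 fun x => ?_)
    exact ((h.differentiable_score x θ).hasFDerivAt.lim_real e).comp
      (tendsto_natCast_atTop_atTop (R := ℝ))
  let b := EuclideanSpace.basisFun (Fin d) ℝ
  have h2 : π.hessLog θ = fun x => ∑ i, (innerSL ℝ (b i)).smulRight (π.hessLog θ x (b i)) := by
    funext x
    ext1 v
    conv_lhs => rw [← b.sum_repr v, map_sum]
    simp [b.repr_apply_apply]
  rw [h2]
  refine Finset.measurable_sum _ fun i _ => ?_
  have hc : Continuous fun w : Param d => (innerSL ℝ (b i)).smulRight w :=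
    (ContinuousLinearMap.smulRightL ℝ (Param d) (Param d) (innerSL ℝ (b i))).continuous
  exact hc.measurable.comp (h1 (b i))

theorem IsELS.isSmoothFamily (h : π.IsELS G F) (s : S) :
    IsSmoothFamily π.ref (fun θ a => π.density θ s a) (fun θ a => π.score θ (s, a)) (G ^ 2) F where
  measurable_density := π.measurable_density_joint.comp
    (f := fun z : Param d × A => (z.1, (s, z.2))) (by fun_prop)
  measurable_score := π.measurable_score.comp
    (f := fun z : Param d × A => (z.1, (s, z.2))) (by fun_prop)
  density_nonneg θ a := π.density_nonneg θ s a
  hasGradientAt_density θ a := π.hasGradientAt_density θ (s, a)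
  differentiable_score a := h.differentiable_score (s, a)
  lintegral_density θ := π.lintegral_density θ s
  a_nonneg := sq_nonneg G
  b_nonneg := h.F_pos.le
  score_sq_le θ := by rw [← π.lintegral_at]; exact h.score_sq_le θ s
  fderiv_score_le θ := by rw [← π.lintegral_at]; exact h.hessLog_le θ s

theorem IsELS.memLp_score (h : π.IsELS G F) (θ : Param d) (s : S) :
    MemLp (fun a => π.score θ (s, a)) 2 (π.at θ s) := by
  refine ⟨((π.measurable_score_at θ).comp measurable_prodMk_left).aestronglyMeasurable, ?_⟩
  rw [eLpNorm_lt_top_iff_lintegral_rpow_enorm_lt_top two_ne_zero ENNReal.ofNat_ne_top]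
  simpa using (h.score_sq_le θ s).trans_lt ENNReal.ofReal_lt_top

/-- Differentiate the constant total mass `∫ p = 1`, that is, take `f = 1` in the score identity.
This is the martingale-difference property of the scores. -/
theorem IsELS.integral_score (h : π.IsELS G F) (θ : Param d) (s : S) :
    ∫ a, π.score θ (s, a) ∂(π.at θ s) = 0 := by
  have h1 := (h.isSmoothFamily s).hasGradientAt_integral (f := fun _ => 1) (K := 1)
    measurable_const zero_le_one (by simp) θ
  have h2 : ∀ θ, ∫ a, π.density θ s a ∂π.ref = 1 := fun θ => by
    rw [integral_eq_lintegral_of_nonneg_ae (ae_of_all _ (π.density_nonneg θ s))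
      ((h.isSmoothFamily s).measurable_density_at θ).aestronglyMeasurable, π.lintegral_density,
      ENNReal.toReal_one]
  simp only [one_mul, one_smul, h2] at h1
  rw [at_apply, integral_withDensity_eq_integral_toReal_smul (π.measurable_ofReal_density θ s)
    (ae_of_all _ fun _ => ENNReal.ofReal_lt_top)]
  simp only [ENNReal.toReal_ofReal (π.density_nonneg _ _ _)]
  exact h1.unique (hasGradientAt_const θ 1)

/-- The cross term vanishes because the score has mean zero; here `v` plays the role of the score
accumulated in the past. -/
theorem IsELS.lintegral_add_score_sq_le (h : π.IsELS G F) (θ : Param d) (s : S) (v : Param d) :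
    ∫⁻ a, ‖v + π.score θ (s, a)‖ₑ ^ 2 ∂(π.at θ s) ≤ ‖v‖ₑ ^ 2 + ENNReal.ofReal (G ^ 2) := by
  have hL := h.memLp_score θ s
  have hi := hL.integrable one_le_two
  have hsq := hL.integrable_norm_pow two_ne_zero
  have e : ∀ w : Param d, ‖w‖ₑ ^ 2 = ENNReal.ofReal (‖w‖ ^ 2) := fun w => by
    rw [ENNReal.ofReal_pow (norm_nonneg _), ofReal_norm]
  have h1 : ∫ a, ‖v + π.score θ (s, a)‖ ^ 2 ∂(π.at θ s) =
      ‖v‖ ^ 2 + ∫ a, ‖π.score θ (s, a)‖ ^ 2 ∂(π.at θ s) := by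
    simp_rw [norm_add_sq_real]
    rw [integral_add (f := fun a => ‖v‖ ^ 2 + 2 * inner ℝ v (π.score θ (s, a)))
      ((integrable_const _).add ((hi.const_inner v).const_mul 2)) hsq, integral_add (integrable_const _) ((hi.const_inner v).const_mul 2), integral_const_mul,
      integral_inner hi, h.integral_score]
    simp
  have h2 := h.score_sq_le θ s
  simp_rw [e] at h2 ⊢
  have hi' : Integrable (fun a => ‖v + π.score θ (s, a)‖ ^ 2) (π.at θ s) :=
    ((memLp_const v).add hL).integrable_norm_pow two_ne_zero
  rw [← ofReal_integral_eq_lintegral_ofReal hsq (ae_of_all _ fun _ => sq_nonneg _)] at h2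
  rw [← ofReal_integral_eq_lintegral_ofReal hi' (ae_of_all _ fun _ => sq_nonneg _), h1,
    ENNReal.ofReal_add (sq_nonneg _) (integral_nonneg fun _ => sq_nonneg _)]
  gcongr

end Policy

/-! The one-step Markov structure of the trajectory law. -/

/-- The law of the state at time `n` given the past: `ρ` for `n = 0`, `P(· ∣ s_{n-1}, a_{n-1})`
for `n ≥ 1`. -/
noncomputable def nextState (M : MDP S A) : ℕ → Kernel (Traj S A) S
  | 0 => Kernel.const _ M.init
  | n + 1 => M.transition.comap (fun τ => τ n) (by fun_prop)

instance (M : MDP S A) (n : ℕ) : IsMarkovKernel (nextState M n) := by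
  cases n <;> (unfold nextState; infer_instance)

theorem nextState_congr (M : MDP S A) (n : ℕ) {τ τ' : Traj S A}
    (h : ∀ i ∈ Set.Iio n, τ i = τ' i) : nextState M n τ = nextState M n τ' := by
  cases n with
  | zero => rfl
  | succ n => simp only [nextState, Kernel.comap_apply, h n (Set.mem_Iio.2 n.lt_succ_self)]

/-- The law of the state-action pair at time `n` given the past. -/
noncomputable def nextPair (M : MDP S A) (π : Policy d S A) (θ : Param d) (n : ℕ) :
    Kernel (Traj S A) (S × A) :=
  nextState M n ⊗ₖ Kernel.prodMkLeft (Traj S A) (π.at θ)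

instance (M : MDP S A) (π : Policy d S A) (θ : Param d) (n : ℕ) :
    IsMarkovKernel (nextPair M π θ n) := by
  unfold nextPair; infer_instance

variable (M : MDP S A) (π : Policy d S A)

theorem lintegral_nextPair (θ : Param d) (n : ℕ) (τ : Traj S A) {f : S × A → ℝ≥0∞}
    (hf : Measurable f) :
    ∫⁻ y, f y ∂(nextPair M π θ n τ) = ∫⁻ s, ∫⁻ a, f (s, a) ∂(π.at θ s) ∂(nextState M n τ) := by
  rw [nextPair, Kernel.lintegral_compProd _ _ _ hf]
  rfl

theorem measurable_update (n : ℕ) :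
    Measurable fun p : Traj S A × (S × A) => Function.update p.1 n p.2 := by
  refine measurable_pi_iff.2 fun i => ?_
  by_cases h : i = n
  · subst h; simp only [Function.update_self]; fun_prop
  · simp only [Function.update_of_ne h]; fun_prop

/-- The tower property: the last relevant coordinate may be resampled from its conditional law given
the past. Phrasing it with `Function.update` and `DependsOn` keeps all functions on the full
trajectory space, so that inductions on the horizon need no change of space. -/
theorem lintegral_trajLaw_succ (θ : Param d) (n : ℕ) {f : Traj S A → ℝ≥0∞} (hf : Measurable f)
    (hd : DependsOn f (Set.Iio (n + 1))) :
    ∫⁻ τ, f τ ∂(trajLaw M π θ) =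
      ∫⁻ τ, ∫⁻ y, f (Function.update τ n y) ∂(nextPair M π θ n τ) ∂(trajLaw M π θ) := by
  cases n with
  | zero =>
    have h0 : (trajLaw M π θ).map (fun τ => τ 0) = M.init ⊗ₘ π.at θ := by
      have e : (fun τ : Traj S A => τ 0) =
          (MeasurableEquiv.piUnique (fun _ : Finset.Iic (0 : ℕ) => S × A)) ∘
            Preorder.frestrictLe (π := fun _ => S × A) 0 := rfl
      rw [e, ← Measure.map_map (MeasurableEquiv.measurable _) (by fun_prop), trajLaw,
        Kernel.trajMeasure, Measure.map_comp _ _ (by fun_prop), Kernel.traj_map_frestrictLe,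
        Kernel.partialTraj_self, Measure.id_comp, MeasurableEquiv.map_map_symm]
    have h1 : ∀ τ τ' : Traj S A, f τ = f (Function.update τ' 0 (τ 0)) := fun τ τ' => by
      refine hd fun i hi => ?_
      have : i = 0 := by simpa using hi
      subst this
      simp
    have hu : ∀ τ', Measurable fun y : S × A => f (Function.update τ' 0 y) := fun τ' =>
      hf.comp ((measurable_update (S := S) (A := A) 0).comp (measurable_prodMk_left (x := τ')))
    have h2 : ∀ τ' τ : Traj S A, nextPair M π θ 0 τ = M.init ⊗ₘ π.at θ := fun τ' τ => by
      ext s hs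
      rw [nextPair, Kernel.compProd_apply hs, Measure.compProd_apply hs]
      rfl
    obtain ⟨τ'⟩ : Nonempty (Traj S A) := nonempty_of_isProbabilityMeasure (trajLaw M π θ)
    have h3 : ∀ τ : Traj S A, ∫⁻ y, f (Function.update τ 0 y) ∂(nextPair M π θ 0 τ) =
        ∫⁻ y, f (Function.update τ' 0 y) ∂(M.init ⊗ₘ π.at θ) := fun τ => by
      rw [h2 τ' τ]
      refine lintegral_congr fun y => ?_
      rw [h1 _ τ', Function.update_self]
    simp_rw [h3]
    rw [lintegral_const, measure_univ, mul_one, ← h0, lintegral_map (hu τ') (by fun_prop)]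
    exact lintegral_congr fun τ => h1 τ τ'
  | succ n =>
    -- Turns a history and its next pair into a full trajectory by repeating the pair for ever; `f`
    -- does not see beyond coordinate `n + 1`, so the padding is harmless.
    let ext : ((i : Finset.Iic n) → S × A) × (S × A) → Traj S A := fun p i =>
      if h : i ≤ n then p.1 ⟨i, Finset.mem_Iic.2 h⟩ else p.2
    have hext : Measurable ext := by
      refine measurable_pi_iff.2 fun i => ?_
      by_cases h : i ≤ n
      · simp only [ext, h, dif_pos]; fun_prop
      · simp only [ext, h, dif_neg, not_false_eq_true]; fun_prop
    have h1 : ∀ (τ : Traj S A) (y : S × A), f (Function.update τ (n + 1) y) =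
        f (ext (Preorder.frestrictLe (π := fun _ => S × A) n τ, y)) := fun τ y => by
      refine hd fun i hi => ?_
      by_cases h : i ≤ n
      · have : i ≠ n + 1 := by omega
        simp [ext, h, this]
      · have : i = n + 1 := by have := Set.mem_Iio.1 hi; omega
        subst this
        simp [ext]
    have h2 : ∀ τ : Traj S A, nextPair M π θ (n + 1) τ = stepKernel M π θ (τ n) := fun τ => by
      ext s hs
      rw [nextPair, stepKernel, Kernel.compProd_apply hs, Kernel.compProd_apply hs]
      rfl
    have h3 := Kernel.map_frestrictLe_trajMeasure_compProd_eq_map_trajMeasure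
      (X := fun _ => S × A) (μ₀ := M.init ⊗ₘ π.at θ) (κ := histKernel M π θ) (a := n)
    rw [← trajLaw] at h3
    have hfe : Measurable (f ∘ ext) := hf.comp hext
    have hfu : Measurable (Function.uncurry fun h y => (f ∘ ext) (h, y)) := hfe
    calc ∫⁻ τ, f τ ∂(trajLaw M π θ)
        = ∫⁻ τ, (f ∘ ext) (Preorder.frestrictLe (π := fun _ => S × A) n τ, τ (n + 1))
            ∂(trajLaw M π θ) := by
          refine lintegral_congr fun τ => ?_
          rw [Function.comp_apply, ← h1, Function.update_eq_self]
      _ = ∫⁻ p, (f ∘ ext) p ∂((trajLaw M π θ).map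
            fun τ => (Preorder.frestrictLe (π := fun _ => S × A) n τ, τ (n + 1))) :=
          (lintegral_map hfe (by fun_prop)).symm
      _ = ∫⁻ h, ∫⁻ y, (f ∘ ext) (h, y) ∂(histKernel M π θ n h)
            ∂((trajLaw M π θ).map (Preorder.frestrictLe (π := fun _ => S × A) n)) := by
          rw [← h3, Measure.lintegral_compProd hfe]
      _ = _ := by
          rw [lintegral_map (Measurable.lintegral_kernel_prod_right hfu) (by fun_prop)]
          refine lintegral_congr fun τ => ?_
          rw [h2]
          simp only [h1]
          rfl

end

section

variable {d : ℕ} {S : Type u} {A : Type v} [MeasurableSpace S] [MeasurableSpace A]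

/-! Change of measure on trajectories. -/

/-- The likelihood ratio of the first `n` steps of a trajectory, relative to the parameter `0`. -/
noncomputable def likelihoodRatio (π : Policy d S A) (n : ℕ) (θ : Param d) (τ : Traj S A) : ℝ :=
  ∏ k ∈ Finset.range n, π.density θ (τ k).1 (τ k).2 / π.density 0 (τ k).1 (τ k).2

/-- The score of the first `n` steps of a trajectory. -/
noncomputable def scoreSum (π : Policy d S A) (n : ℕ) (θ : Param d) (τ : Traj S A) : Param d :=
  ∑ k ∈ Finset.range n, π.score θ (τ k)

variable (M : MDP S A) (π : Policy d S A)

theorem measurable_likelihoodRatio (n : ℕ) :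
    Measurable fun p : Param d × Traj S A => likelihoodRatio π n p.1 p.2 := by
  refine Finset.measurable_prod _ fun k _ => ?_
  exact (π.measurable_density_joint.comp (f := fun p : Param d × Traj S A => (p.1, p.2 k))
    (by fun_prop)).div (π.measurable_density_joint.comp
      (f := fun p : Param d × Traj S A => (0, p.2 k)) (by fun_prop))

theorem measurable_scoreSum (n : ℕ) :
    Measurable fun p : Param d × Traj S A => scoreSum π n p.1 p.2 :=
  Finset.measurable_sum _ fun k _ => π.measurable_score.comp
    (f := fun p : Param d × Traj S A => (p.1, p.2 k)) (by fun_prop)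

theorem measurable_likelihoodRatio_at (n : ℕ) (θ : Param d) :
    Measurable (likelihoodRatio (S := S) (A := A) π n θ) :=
  (measurable_likelihoodRatio π n).comp measurable_prodMk_left

theorem measurable_scoreSum_at (n : ℕ) (θ : Param d) :
    Measurable (scoreSum (S := S) (A := A) π n θ) :=
  (measurable_scoreSum π n).comp (f := fun τ : Traj S A => (θ, τ)) (by fun_prop)

theorem likelihoodRatio_nonneg (n : ℕ) (θ : Param d) (τ : Traj S A) :
    0 ≤ likelihoodRatio π n θ τ :=
  Finset.prod_nonneg fun _ _ => div_nonneg (π.density_nonneg _ _ _) (π.density_nonneg _ _ _)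

theorem dependsOn_likelihoodRatio (n : ℕ) (θ : Param d) :
    DependsOn (likelihoodRatio (S := S) (A := A) π n θ) (Set.Iio n) := fun τ τ' h =>
  Finset.prod_congr rfl fun k hk => by rw [h k (Set.mem_Iio.2 (Finset.mem_range.1 hk))]

theorem dependsOn_scoreSum (n : ℕ) (θ : Param d) :
    DependsOn (scoreSum (S := S) (A := A) π n θ) (Set.Iio n) := fun τ τ' h =>
  Finset.sum_congr rfl fun k hk => by rw [h k (Set.mem_Iio.2 (Finset.mem_range.1 hk))]

theorem likelihoodRatio_succ_update (n : ℕ) (θ : Param d) (τ : Traj S A) (y : S × A) :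
    likelihoodRatio π (n + 1) θ (Function.update τ n y) =
      likelihoodRatio π n θ τ * (π.density θ y.1 y.2 / π.density 0 y.1 y.2) := by
  rw [likelihoodRatio, Finset.prod_range_succ, Function.update_self]
  congr 1
  refine Finset.prod_congr rfl fun k hk => ?_
  rw [Function.update_of_ne (Finset.mem_range.1 hk).ne]

theorem scoreSum_succ_update (n : ℕ) (θ : Param d) (τ : Traj S A) (y : S × A) :
    scoreSum π (n + 1) θ (Function.update τ n y) = scoreSum π n θ τ + π.score θ y := by
  rw [scoreSum, Finset.sum_range_succ, Function.update_self]
  congr 1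
  refine Finset.sum_congr rfl fun k hk => ?_
  rw [Function.update_of_ne (Finset.mem_range.1 hk).ne]

/-- The state kernel does not depend on the parameter, so only the ratio of the policy densities
survives. -/
theorem lintegral_nextPair_eq_ratio (θ : Param d) (n : ℕ) (τ : Traj S A) {f : S × A → ℝ≥0∞}
    (hf : Measurable f) :
    ∫⁻ y, f y ∂(nextPair M π θ n τ) =
      ∫⁻ y, ENNReal.ofReal (π.density θ y.1 y.2 / π.density 0 y.1 y.2) * f y
        ∂(nextPair M π 0 n τ) := by
  have hr : Measurable fun y : S × A =>
      ENNReal.ofReal (π.density θ y.1 y.2 / π.density 0 y.1 y.2) * f y :=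
    ((π.measurable_density θ).div (π.measurable_density 0)).ennreal_ofReal.mul hf
  rw [lintegral_nextPair M π θ n τ hf, lintegral_nextPair M π 0 n τ hr]
  refine lintegral_congr fun s => ?_
  rw [π.lintegral_at, π.lintegral_at]
  refine lintegral_congr fun a => ?_
  rw [← mul_assoc, ← ENNReal.ofReal_mul (π.density_nonneg _ _ _)]
  congr 2
  -- Where the reference density vanishes, so does the density at `θ`; hence the convention `x / 0 =
  -- 0` loses no mass.
  by_cases h0 : π.density 0 s a = 0
  · rw [h0, zero_mul, (π.density_eq_zero_iff 0 θ s a).1 h0]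
  · simp only; field_simp

theorem measurable_lintegral_nextPair (θ : Param d) (n : ℕ) {f : Traj S A → ℝ≥0∞}
    (hf : Measurable f) :
    Measurable fun τ => ∫⁻ y, f (Function.update τ n y) ∂(nextPair M π θ n τ) := by
  have h : Measurable (Function.uncurry fun (τ : Traj S A) y => f (Function.update τ n y)) :=
    hf.comp (measurable_update n)
  exact Measurable.lintegral_kernel_prod_right h

theorem dependsOn_lintegral_nextPair (θ : Param d) (n : ℕ) {f : Traj S A → ℝ≥0∞}
    (hd : DependsOn f (Set.Iio (n + 1))) :
    DependsOn (fun τ => ∫⁻ y, f (Function.update τ n y) ∂(nextPair M π θ n τ)) (Set.Iio n) := by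
  intro τ τ' h
  have h1 : nextPair M π θ n τ = nextPair M π θ n τ' := by
    ext s hs
    rw [nextPair, Kernel.compProd_apply hs, Kernel.compProd_apply hs, nextState_congr M n h]
    rfl
  simp only
  rw [h1]
  refine lintegral_congr fun y => hd fun i hi => ?_
  by_cases hin : i = n
  · subst hin; simp
  · rw [Function.update_of_ne hin, Function.update_of_ne hin]
    exact h i (Set.mem_Iio.2 (by have := Set.mem_Iio.1 hi; omega))

/-- Integrate out the last step, apply the induction hypothesis to the resulting function of the
past, then change measure in the one-step kernel and reassemble. -/
theorem lintegral_trajLaw_eq_ratio (θ : Param d) (n : ℕ) {f : Traj S A → ℝ≥0∞} (hf : Measurable f)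
    (hd : DependsOn f (Set.Iio n)) :
    ∫⁻ τ, f τ ∂(trajLaw M π θ) =
      ∫⁻ τ, ENNReal.ofReal (likelihoodRatio π n θ τ) * f τ ∂(trajLaw M π 0) := by
  induction n generalizing f with
  | zero =>
    obtain ⟨τ₀⟩ : Nonempty (Traj S A) := nonempty_of_isProbabilityMeasure (trajLaw M π 0)
    have h : ∀ τ, f τ = f τ₀ := fun τ => hd (by simp)
    simp [likelihoodRatio, h]
  | succ n ih =>
    have hu : ∀ τ, Measurable fun y => f (Function.update τ n y) := fun τ =>
      hf.comp ((measurable_update n).comp measurable_prodMk_left)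
    have hr : Measurable fun τ => ENNReal.ofReal (likelihoodRatio π (n + 1) θ τ) * f τ :=
      (measurable_likelihoodRatio_at π (n + 1) θ).ennreal_ofReal.mul hf
    have hrd : DependsOn (fun τ => ENNReal.ofReal (likelihoodRatio π (n + 1) θ τ) * f τ)
        (Set.Iio (n + 1)) := fun τ τ' h => by
      simp only
      rw [hd h, dependsOn_likelihoodRatio π (n + 1) θ h]
    rw [lintegral_trajLaw_succ M π θ n hf hd,
      ih (measurable_lintegral_nextPair M π θ n hf) (dependsOn_lintegral_nextPair M π θ n hd),
      lintegral_trajLaw_succ M π 0 n hr hrd]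
    refine lintegral_congr fun τ => ?_
    rw [lintegral_nextPair_eq_ratio M π θ n τ (hu τ), ← lintegral_const_mul' _ _
      ENNReal.ofReal_ne_top]
    refine lintegral_congr fun y => ?_
    rw [likelihoodRatio_succ_update, ENNReal.ofReal_mul (likelihoodRatio_nonneg _ _ _ _), mul_assoc]

theorem integral_trajLaw_eq_ratio {E : Type*} [NormedAddCommGroup E] [NormedSpace ℝ E]
    (θ : Param d) (n : ℕ) {f : Traj S A → E} (hf : StronglyMeasurable f)
    (hd : DependsOn f (Set.Iio n)) :
    ∫ τ, f τ ∂(trajLaw M π θ) = ∫ τ, likelihoodRatio π n θ τ • f τ ∂(trajLaw M π 0) := by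
  obtain ⟨τ₀⟩ : Nonempty (Traj S A) := nonempty_of_isProbabilityMeasure (trajLaw M π 0)
  -- The two measures need to agree only on the first `n` coordinates. Freezing all later
  -- coordinates at `τ₀` makes their push-forwards equal as measures, which carries the change of
  -- measure over to Bochner integrals.
  let r : Traj S A → Traj S A := fun τ i => if i < n then τ i else τ₀ i
  have hr : Measurable r := by
    refine measurable_pi_iff.2 fun i => ?_
    by_cases h : i < n
    · simp only [r, h, if_true]; fun_prop
    · simp only [r, h, if_false]; fun_prop
  have hrd : DependsOn r (Set.Iio n) := fun τ τ' h => by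
    funext i
    by_cases hi : i < n
    · simp [r, hi, h i hi]
    · simp [r, hi]
  have hfr : ∀ τ, f τ = f (r τ) := fun τ => hd fun i hi => by simp [r, Set.mem_Iio.1 hi]
  have hm := (measurable_likelihoodRatio_at (S := S) (A := A) π n θ).ennreal_ofReal
  have h1 : (trajLaw M π θ).map r = ((trajLaw M π 0).withDensity fun τ =>
      ENNReal.ofReal (likelihoodRatio π n θ τ)).map r := by
    refine Measure.ext_of_lintegral _ fun g hg => ?_
    rw [lintegral_map hg hr, lintegral_map hg hr, lintegral_withDensity_eq_lintegral_mul _ hm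
      (g := fun τ => g (r τ)) (hg.comp hr), lintegral_trajLaw_eq_ratio M π θ n (f := fun τ => g (r τ)) (hg.comp hr)
        fun τ τ' h => congrArg g (hrd h)]
    rfl
  calc ∫ τ, f τ ∂(trajLaw M π θ) = ∫ τ, f τ ∂((trajLaw M π θ).map r) := by
        rw [integral_map hr.aemeasurable hf.aestronglyMeasurable]
        exact integral_congr_ae (ae_of_all _ hfr)
    _ = ∫ τ, f τ ∂((trajLaw M π 0).withDensity fun τ =>
          ENNReal.ofReal (likelihoodRatio π n θ τ)) := by
        rw [h1, integral_map hr.aemeasurable hf.aestronglyMeasurable]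
        exact integral_congr_ae (ae_of_all _ fun τ => (hfr τ).symm)
    _ = _ := by
        rw [integral_withDensity_eq_integral_toReal_smul hm
          (ae_of_all _ fun _ => ENNReal.ofReal_lt_top)]
        simp only [ENNReal.toReal_ofReal (likelihoodRatio_nonneg _ _ _ _)]

/-! Moments of the score, and differentiation of expectations over trajectories. -/

variable {M π} {G F : ℝ}

/-- Each new score is orthogonal to the accumulated ones, so second moments add. Growth `n` in place
of `n²` is essential for the power of `1 - γ` in `L` and `ν`. -/
theorem Policy.IsELS.lintegral_scoreSum_sq_le (h : π.IsELS G F) (θ : Param d) (n : ℕ) :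
    ∫⁻ τ, ‖scoreSum π n θ τ‖ₑ ^ 2 ∂(trajLaw M π θ) ≤ ENNReal.ofReal (n * G ^ 2) := by
  induction n with
  | zero => simp [scoreSum]
  | succ n ih =>
    rw [lintegral_trajLaw_succ M π θ n ((measurable_scoreSum_at π (n + 1) θ).enorm.pow_const 2)
      (fun τ τ' hτ => congrArg (fun v => ‖v‖ₑ ^ 2) (dependsOn_scoreSum π (n + 1) θ hτ))]
    calc _ ≤ ∫⁻ τ, (‖scoreSum π n θ τ‖ₑ ^ 2 + ENNReal.ofReal (G ^ 2)) ∂(trajLaw M π θ) := by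
          refine lintegral_mono fun τ => ?_
          simp only [scoreSum_succ_update]
          rw [lintegral_nextPair M π θ n τ
            (((π.measurable_score_at θ).const_add _).enorm.pow_const 2)]
          refine (lintegral_mono fun s =>
            h.lintegral_add_score_sq_le θ s (scoreSum π n θ τ)).trans_eq ?_
          simp
      _ = (∫⁻ τ, ‖scoreSum π n θ τ‖ₑ ^ 2 ∂(trajLaw M π θ)) + ENNReal.ofReal (G ^ 2) := by
          rw [lintegral_add_right _ measurable_const]
          simp
      _ ≤ ENNReal.ofReal (n * G ^ 2) + ENNReal.ofReal (G ^ 2) := by gcongr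
      _ = _ := by
          rw [← ENNReal.ofReal_add (by positivity) (by positivity)]
          congr 1
          push_cast
          ring

theorem Policy.IsELS.lintegral_hessLog_le (h : π.IsELS G F) (θ : Param d) (k : ℕ) :
    ∫⁻ τ, ‖π.hessLog θ (τ k)‖ₑ ∂(trajLaw M π θ) ≤ ENNReal.ofReal F := by
  have hm := (h.measurable_hessLog θ).enorm
  rw [lintegral_trajLaw_succ M π θ k (f := fun τ => ‖π.hessLog θ (τ k)‖ₑ)
    (hm.comp (measurable_pi_apply k))
    (fun τ τ' hτ => by simp only; rw [hτ k (Set.mem_Iio.2 k.lt_succ_self)])]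
  simp only [Function.update_self]
  calc _ ≤ ∫⁻ _, ENNReal.ofReal F ∂(trajLaw M π θ) := by
        refine lintegral_mono fun τ => ?_
        rw [lintegral_nextPair M π θ k τ hm]
        refine (lintegral_mono fun s => h.hessLog_le θ s).trans_eq ?_
        simp
    _ = _ := by simp

/-- Brings the abstract L¹ calculus to trajectories. Both constants are linear in the number of
steps. -/
theorem Policy.IsELS.isSmoothFamily_traj (h : π.IsELS G F) (n : ℕ) :
    IsSmoothFamily (trajLaw M π 0) (likelihoodRatio π n) (scoreSum π n) (n * G ^ 2) (n * F) where
  measurable_density := measurable_likelihoodRatio π n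
  measurable_score := measurable_scoreSum π n
  density_nonneg := likelihoodRatio_nonneg π n
  hasGradientAt_density θ τ := by
    rw [hasGradientAt_iff_hasFDerivAt]
    induction n with
    | zero =>
      simp only [likelihoodRatio, scoreSum, Finset.range_zero, Finset.prod_empty, Finset.sum_empty,
        smul_zero, map_zero]
      exact hasFDerivAt_const 1 θ
    | succ n ih =>
      have h1 := ((π.hasGradientAt_density θ (τ n)).hasFDerivAt).mul_const
        (π.density 0 (τ n).1 (τ n).2)⁻¹
      have h2 := ih.mul h1
      have e : (fun θ => likelihoodRatio π (n + 1) θ τ) = fun θ => likelihoodRatio π n θ τ *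
          (π.density θ (τ n).1 (τ n).2 * (π.density 0 (τ n).1 (τ n).2)⁻¹) := by
        funext θ
        rw [likelihoodRatio, Finset.prod_range_succ, div_eq_mul_inv]
        rfl
      rw [e]
      refine h2.congr_fderiv ?_
      have es : scoreSum π (n + 1) θ τ = scoreSum π n θ τ + π.score θ (τ n) :=
        Finset.sum_range_succ _ _
      rw [congrFun e θ, es]
      simp only [map_smul, map_add, smul_add, smul_smul]
      rw [add_comm]
      congr 1
      · congr 1; ring
      · congr 1; ring
  differentiable_score τ := by
    unfold scoreSum
    exact Differentiable.fun_sum fun k _ => h.differentiable_score (τ k)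
  lintegral_density θ := by
    have := lintegral_trajLaw_eq_ratio M π θ n (f := fun _ => 1) measurable_const
      (fun _ _ _ => rfl)
    simpa using this.symm
  a_nonneg := by positivity
  b_nonneg := mul_nonneg (Nat.cast_nonneg n) h.F_pos.le
  score_sq_le θ := by
    rw [← lintegral_trajLaw_eq_ratio M π θ n
      ((measurable_scoreSum_at π n θ).enorm.pow_const 2)
      (fun τ τ' hτ => congrArg (fun v => ‖v‖ₑ ^ 2) (dependsOn_scoreSum π n θ hτ))]
    exact h.lintegral_scoreSum_sq_le θ n
  fderiv_score_le θ := by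
    have hm : ∀ k, Measurable fun τ : Traj S A => ‖π.hessLog θ (τ k)‖ₑ := fun k =>
      (h.measurable_hessLog θ).enorm.comp (measurable_pi_apply k)
    calc _ ≤ ∫⁻ τ, ENNReal.ofReal (likelihoodRatio π n θ τ) *
          ∑ k ∈ Finset.range n, ‖π.hessLog θ (τ k)‖ₑ ∂(trajLaw M π 0) := by
          refine lintegral_mono fun τ => ?_
          gcongr
          unfold scoreSum
          rw [fderiv_fun_sum fun k _ => h.differentiable_score (τ k) θ]
          exact enorm_sum_le (Finset.range n) fun k => π.hessLog θ (τ k)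
      _ = ∫⁻ τ, ∑ k ∈ Finset.range n, ‖π.hessLog θ (τ k)‖ₑ ∂(trajLaw M π θ) :=
          (lintegral_trajLaw_eq_ratio M π θ n (Finset.measurable_sum _ fun k _ => hm k)
            fun τ τ' hτ => Finset.sum_congr rfl fun k hk => by
              rw [hτ k (Set.mem_Iio.2 (Finset.mem_range.1 hk))]).symm
      _ = ∑ k ∈ Finset.range n, ∫⁻ τ, ‖π.hessLog θ (τ k)‖ₑ ∂(trajLaw M π θ) :=
          lintegral_finsetSum _ fun k _ => hm k
      _ ≤ ∑ k ∈ Finset.range n, ENNReal.ofReal F :=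
          Finset.sum_le_sum fun k _ => h.lintegral_hessLog_le θ k
      _ = _ := by
          rw [Finset.sum_const, Finset.card_range, nsmul_eq_mul, ENNReal.ofReal_mul
            (Nat.cast_nonneg n), ENNReal.ofReal_natCast]

theorem Policy.IsELS.memLp_scoreSum (h : π.IsELS G F) (θ : Param d) (n : ℕ) :
    MemLp (scoreSum π n θ) 2 (trajLaw M π θ) := by
  refine ⟨(measurable_scoreSum_at π n θ).aestronglyMeasurable, ?_⟩
  rw [eLpNorm_lt_top_iff_lintegral_rpow_enorm_lt_top two_ne_zero ENNReal.ofNat_ne_top]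
  simpa using (h.lintegral_scoreSum_sq_le (M := M) θ n).trans_lt ENNReal.ofReal_lt_top

theorem Policy.IsELS.integral_scoreSum_sq_le (h : π.IsELS G F) (θ : Param d) (n : ℕ) :
    ∫ τ, ‖scoreSum π n θ τ‖ ^ 2 ∂(trajLaw M π θ) ≤ n * G ^ 2 := by
  have hi := (h.memLp_scoreSum (M := M) θ n).integrable_norm_pow two_ne_zero
  have h1 := h.lintegral_scoreSum_sq_le (M := M) θ n
  simp_rw [← ofReal_norm, ← ENNReal.ofReal_pow (norm_nonneg _)] at h1
  rw [← ofReal_integral_eq_lintegral_ofReal hi (ae_of_all _ fun _ => sq_nonneg _)] at h1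
  exact (ENNReal.ofReal_le_ofReal_iff (by positivity)).1 h1

variable {f : Traj S A → ℝ} {K : ℝ} {n : ℕ}

/-- The L¹ norm of the score is at most its L² norm under a probability law, hence at most `√n G`.
-/
theorem Policy.IsELS.norm_integral_smul_scoreSum_le (h : π.IsELS G F) (hK0 : 0 ≤ K)
    (hK : ∀ τ, |f τ| ≤ K) (θ : Param d) :
    ‖∫ τ, f τ • scoreSum π n θ τ ∂(trajLaw M π θ)‖ ≤ K * (√n * G) := by
  have hL := h.memLp_scoreSum (M := M) θ n
  refine IsSmoothFamily.norm_integral_smul_le (by have := h.G_pos; positivity) hK0 hK ?_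
  have h1 := eLpNorm_le_eLpNorm_of_exponent_le (p := 1) (q := 2) one_le_two hL.1
  rw [eLpNorm_one_eq_lintegral_enorm] at h1
  refine h1.trans ?_
  rw [eLpNorm_eq_lintegral_rpow_enorm_toReal two_ne_zero ENNReal.ofNat_ne_top]
  have h2 := h.lintegral_scoreSum_sq_le (M := M) θ n
  simp only [ENNReal.toReal_ofNat, ENNReal.rpow_ofNat]
  refine (ENNReal.rpow_le_rpow h2 (by norm_num)).trans_eq ?_
  rw [ENNReal.ofReal_rpow_of_nonneg (by positivity) (by norm_num), ← Real.sqrt_eq_rpow,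
    Real.sqrt_mul (Nat.cast_nonneg n), Real.sqrt_sq h.G_pos.le]

theorem integral_eq_integral_mul_likelihoodRatio (hf : Measurable f)
    (hd : DependsOn f (Set.Iio n)) (θ : Param d) :
    ∫ τ, f τ ∂(trajLaw M π θ) = ∫ τ, f τ * likelihoodRatio π n θ τ ∂(trajLaw M π 0) := by
  rw [integral_trajLaw_eq_ratio M π θ n hf.stronglyMeasurable hd]
  simp only [smul_eq_mul, mul_comm]

theorem integral_smul_scoreSum_eq (hf : Measurable f) (hd : DependsOn f (Set.Iio n))
    (θ : Param d) :
    ∫ τ, f τ • scoreSum π n θ τ ∂(trajLaw M π θ) =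
      ∫ τ, f τ • likelihoodRatio π n θ τ • scoreSum π n θ τ ∂(trajLaw M π 0) := by
  rw [integral_trajLaw_eq_ratio M π θ n (f := fun τ => f τ • scoreSum π n θ τ)
    (hf.smul (measurable_scoreSum_at π n θ)).stronglyMeasurable
    (fun τ τ' hτ => by simp only; rw [hd hτ, dependsOn_scoreSum π n θ hτ])]
  simp only [smul_smul, mul_comm]

theorem Policy.IsELS.hasGradientAt_integral (h : π.IsELS G F) (hf : Measurable f) (hK0 : 0 ≤ K)
    (hK : ∀ τ, |f τ| ≤ K) (hd : DependsOn f (Set.Iio n)) (θ : Param d) :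
    HasGradientAt (fun θ => ∫ τ, f τ ∂(trajLaw M π θ))
      (∫ τ, f τ • scoreSum π n θ τ ∂(trajLaw M π θ)) θ := by
  simp_rw [integral_eq_integral_mul_likelihoodRatio hf hd, integral_smul_scoreSum_eq hf hd]
  exact (h.isSmoothFamily_traj n).hasGradientAt_integral hf hK0 hK θ

theorem Policy.IsELS.norm_integral_smul_scoreSum_sub_le (h : π.IsELS G F) (hf : Measurable f)
    (hK0 : 0 ≤ K) (hK : ∀ τ, |f τ| ≤ K) (hd : DependsOn f (Set.Iio n)) (θ θ' : Param d) :
    ‖(∫ τ, f τ • scoreSum π n θ' τ ∂(trajLaw M π θ')) -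
      ∫ τ, f τ • scoreSum π n θ τ ∂(trajLaw M π θ)‖ ≤ K * (n * (G ^ 2 + F)) * ‖θ' - θ‖ := by
  rw [integral_smul_scoreSum_eq hf hd, integral_smul_scoreSum_eq hf hd, mul_add]
  exact (h.isSmoothFamily_traj n).norm_integral_score_sub_le hf hK0 hK θ θ'

end

/-! Geometric series. -/

theorem hasSum_pow_mul_add_one {r : ℝ} (h0 : 0 ≤ r) (h1 : r < 1) :
    HasSum (fun t : ℕ => r ^ t * ((t : ℝ) + 1)) (1 / (1 - r) ^ 2) := by
  have h := hasSum_choose_mul_geometric_of_norm_lt_one 1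
    (by rwa [Real.norm_of_nonneg h0] : ‖r‖ < 1)
  simpa [mul_comm] using h

/-- The tangent-line bound `√x ≤ x / (2c) + c / 2`, with the point of tangency left free. -/
theorem pow_mul_sqrt_le {r c : ℝ} (h0 : 0 ≤ r) (hc : 0 < c) (H t : ℕ) :
    r ^ t * √((t : ℝ) + 1 + H) ≤
      (1 / (2 * c)) * (r ^ t * ((t : ℝ) + 1)) + (H / (2 * c) + c / 2) * r ^ t := by
  have hx : (0 : ℝ) ≤ (t : ℝ) + 1 + H := by positivity
  have h2 : √((t : ℝ) + 1 + H) ≤ ((t : ℝ) + 1 + H) / (2 * c) + c / 2 := by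
    have h3 : ((t : ℝ) + 1 + H) / (2 * c) + c / 2 - √((t : ℝ) + 1 + H) =
        (√((t : ℝ) + 1 + H) - c) ^ 2 / (2 * c) := by
      field_simp
      rw [sub_sq, Real.sq_sqrt hx]
      ring
    have : 0 ≤ (√((t : ℝ) + 1 + H) - c) ^ 2 / (2 * c) := by positivity
    linarith
  calc _ ≤ r ^ t * (((t : ℝ) + 1 + H) / (2 * c) + c / 2) :=
        mul_le_mul_of_nonneg_left h2 (by positivity)
    _ = _ := by ring

theorem summable_pow_mul_sqrt {r : ℝ} (h0 : 0 ≤ r) (h1 : r < 1) (H : ℕ) :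
    Summable fun t : ℕ => r ^ t * √((t : ℝ) + 1 + H) :=
  Summable.of_nonneg_of_le (fun t => by positivity) (fun t => pow_mul_sqrt_le h0 one_pos H t)
    (((hasSum_pow_mul_add_one h0 h1).summable.mul_left _).add
      ((summable_geometric_of_lt_one h0 h1).mul_left _))

/-- Jensen's inequality for `√` under the weights `(1 - r) r^t`, for which `t + 1` has mean `1 / (1
- r)`. It is realised by the tangent line at that mean shifted by `H`, which is the choice of `c`.
-/
theorem tsum_pow_mul_sqrt_le {r : ℝ} (h0 : 0 ≤ r) (h1 : r < 1) (H : ℕ) :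
    ∑' t : ℕ, r ^ t * √((t : ℝ) + 1 + H) ≤ 1 / (1 - r) * √(1 / (1 - r) + H) := by
  have hr : 0 < 1 - r := by linarith
  have hx : 0 < 1 / (1 - r) + H := by positivity
  set c := √(1 / (1 - r) + H) with hc
  have hc0 : 0 < c := Real.sqrt_pos.2 hx
  have hc2 : c ^ 2 = 1 / (1 - r) + H := Real.sq_sqrt hx.le
  have hs := ((hasSum_pow_mul_add_one h0 h1).mul_left (1 / (2 * c))).add
    ((hasSum_geometric_of_lt_one h0 h1).mul_left (H / (2 * c) + c / 2))
  refine ((summable_pow_mul_sqrt h0 h1 H).tsum_le_tsum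
    (fun t => pow_mul_sqrt_le h0 hc0 H t) hs.summable).trans_eq ?_
  rw [hs.tsum_eq]
  have hH : (H : ℝ) = c ^ 2 - 1 / (1 - r) := by linarith
  rw [hH]
  field_simp
  ring

/-! ### The gradient of the expected return: series, smoothness and truncation. -/

section

variable {d : ℕ} {S : Type u} {A : Type v} [MeasurableSpace S] [MeasurableSpace A]

variable {M : MDP S A} {π : Policy d S A} {G F : ℝ}

/-- The law of trajectories is a probability measure, so a state-action pair exists at which the
reward bound can be read. -/
theorem MDP.Rmax_nonneg (M : MDP S A) (π : Policy d S A) : 0 ≤ M.Rmax := by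
  obtain ⟨τ⟩ : Nonempty (Traj S A) := nonempty_of_isProbabilityMeasure (trajLaw M π 0)
  exact (abs_nonneg _).trans (M.abs_reward_le (τ 0))

theorem MDP.one_sub_γ_pos (M : MDP S A) : 0 < 1 - M.γ := sub_pos.2 M.γ_lt_one

theorem measurable_reward_at (M : MDP S A) (t : ℕ) :
    Measurable fun τ : Traj S A => M.reward (τ t) :=
  M.measurable_reward.comp (measurable_pi_apply t)

theorem dependsOn_reward (M : MDP S A) {t n : ℕ} (h : t < n) :
    DependsOn (fun τ : Traj S A => M.reward (τ t)) (Set.Iio n) := fun _ _ hτ =>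
  congrArg M.reward (hτ t h)

/-- The expected reward at time `t`. -/
noncomputable def expReward (M : MDP S A) (π : Policy d S A) (t : ℕ) (θ : Param d) : ℝ :=
  ∫ τ, M.reward (τ t) ∂(trajLaw M π θ)

/-- The gradient of the expected reward at time `t`. -/
noncomputable def rewardGrad (M : MDP S A) (π : Policy d S A) (t : ℕ) (θ : Param d) : Param d :=
  ∫ τ, M.reward (τ t) • scoreSum π (t + 1) θ τ ∂(trajLaw M π θ)

/-- The gradient of the expected return truncated at the horizon `H`. -/
noncomputable def truncGrad (M : MDP S A) (π : Policy d S A) (H : ℕ) (θ : Param d) : Param d :=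
  ∑ t ∈ Finset.range H, M.γ ^ t • rewardGrad M π t θ

theorem abs_expReward_le (t : ℕ) (θ : Param d) : |expReward M π t θ| ≤ M.Rmax := by
  have h := norm_integral_le_of_norm_le_const (μ := trajLaw M π θ)
    (f := fun τ => M.reward (τ t)) (ae_of_all _ fun τ => M.abs_reward_le (τ t))
  simpa [expReward] using h

theorem integrable_reward (t : ℕ) (θ : Param d) :
    Integrable (fun τ => M.reward (τ t)) (trajLaw M π θ) :=
  Integrable.of_bound (measurable_reward_at M t).aestronglyMeasurable M.Rmax
    (ae_of_all _ fun τ => M.abs_reward_le (τ t))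

theorem Policy.IsELS.hasGradientAt_expReward (h : π.IsELS G F) (t : ℕ) (θ : Param d) :
    HasGradientAt (expReward M π t) (rewardGrad M π t θ) θ :=
  h.hasGradientAt_integral (measurable_reward_at M t) (M.Rmax_nonneg π)
    (fun τ => M.abs_reward_le (τ t)) (dependsOn_reward M t.lt_succ_self) θ

/-- Both integrals are gradients of the same expected reward, computed over different horizons
beyond `t`, so uniqueness of the gradient identifies them. This replaces the causality argument that
scores after time `t` are conditionally centred. -/
theorem Policy.IsELS.integral_reward_smul_scoreSum (h : π.IsELS G F) {t n : ℕ} (htn : t < n)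
    (θ : Param d) :
    ∫ τ, M.reward (τ t) • scoreSum π n θ τ ∂(trajLaw M π θ) = rewardGrad M π t θ :=
  (h.hasGradientAt_integral (measurable_reward_at M t) (M.Rmax_nonneg π)
    (fun τ => M.abs_reward_le (τ t)) (dependsOn_reward M htn) θ).unique
    (h.hasGradientAt_expReward t θ)

theorem Policy.IsELS.norm_rewardGrad_le (h : π.IsELS G F) (t : ℕ) (θ : Param d) :
    ‖rewardGrad M π t θ‖ ≤ G * M.Rmax * √((t : ℝ) + 1) := by
  have := h.norm_integral_smul_scoreSum_le (M := M) (n := t + 1) (M.Rmax_nonneg π)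
    (fun τ : Traj S A => M.abs_reward_le (τ t)) θ
  push_cast at this
  refine this.trans_eq ?_
  ring

theorem Policy.IsELS.norm_rewardGrad_sub_le (h : π.IsELS G F) (t : ℕ) (θ θ' : Param d) :
    ‖rewardGrad M π t θ' - rewardGrad M π t θ‖ ≤
      M.Rmax * ((t + 1) * (G ^ 2 + F)) * ‖θ' - θ‖ := by
  have := h.norm_integral_smul_scoreSum_sub_le (M := M) (measurable_reward_at M t) (M.Rmax_nonneg π)
    (fun τ => M.abs_reward_le (τ t)) (dependsOn_reward M t.lt_succ_self) θ θ'
  push_cast at this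
  exact this

theorem Policy.IsELS.norm_pow_smul_rewardGrad_le (h : π.IsELS G F) (t : ℕ) (θ : Param d) :
    ‖M.γ ^ t • rewardGrad M π t θ‖ ≤ G * M.Rmax * (M.γ ^ t * √((t : ℝ) + 1)) := by
  have hγ := M.γ_nonneg
  rw [norm_smul, Real.norm_of_nonneg (by positivity)]
  calc _ ≤ M.γ ^ t * (G * M.Rmax * √((t : ℝ) + 1)) := by gcongr; exact h.norm_rewardGrad_le t θ
    _ = _ := by ring

theorem summable_pow_mul_sqrt_add_one {r : ℝ} (h0 : 0 ≤ r) (h1 : r < 1) :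
    Summable fun t : ℕ => r ^ t * √((t : ℝ) + 1) := by
  simpa using summable_pow_mul_sqrt h0 h1 0

theorem Policy.IsELS.summable_rewardGrad (h : π.IsELS G F) (θ : Param d) :
    Summable fun t => M.γ ^ t • rewardGrad M π t θ :=
  Summable.of_norm_bounded
    ((summable_pow_mul_sqrt_add_one M.γ_nonneg M.γ_lt_one).mul_left (G * M.Rmax))
    fun t => h.norm_pow_smul_rewardGrad_le t θ

theorem abs_pow_mul_reward_le (M : MDP S A) (t : ℕ) (x : S × A) :
    ‖M.γ ^ t * M.reward x‖ ≤ M.Rmax * M.γ ^ t := by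
  rw [norm_mul, Real.norm_of_nonneg (pow_nonneg M.γ_nonneg t), mul_comm]
  exact mul_le_mul_of_nonneg_right (M.abs_reward_le x) (pow_nonneg M.γ_nonneg t)

theorem summable_Rmax_mul_pow (M : MDP S A) : Summable fun t : ℕ => M.Rmax * M.γ ^ t :=
  (summable_geometric_of_lt_one M.γ_nonneg M.γ_lt_one).mul_left _

theorem J_eq_tsum (θ : Param d) : J M π θ = ∑' t, M.γ ^ t * expReward M π t θ := by
  unfold J totalReward
  rw [← integral_tsum_of_summable_integral_norm
    (F := fun t (τ : Traj S A) => M.γ ^ t * M.reward (τ t))]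
  · simp only [integral_const_mul, expReward]
  · exact fun t => (integrable_reward t θ).const_mul _
  · refine Summable.of_nonneg_of_le (fun t => integral_nonneg fun _ => norm_nonneg _) (fun t => ?_)
      (summable_Rmax_mul_pow M)
    have := integral_mono (μ := trajLaw M π θ) ((integrable_reward (M := M) t θ).const_mul
      (M.γ ^ t)).norm (integrable_const (M.Rmax * M.γ ^ t))
      fun τ => abs_pow_mul_reward_le M t (τ t)
    simpa using this

theorem abs_J_le (θ : Param d) : |J M π θ| ≤ M.Rmax / (1 - M.γ) := by
  rw [J_eq_tsum, div_eq_mul_inv, ← Real.norm_eq_abs]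
  refine tsum_of_norm_bounded ((hasSum_geometric_of_lt_one M.γ_nonneg M.γ_lt_one).mul_left
    M.Rmax) fun t => ?_
  rw [norm_mul, Real.norm_of_nonneg (pow_nonneg M.γ_nonneg t), mul_comm]
  exact mul_le_mul_of_nonneg_right (abs_expReward_le t θ) (pow_nonneg M.γ_nonneg t)

theorem bddAbove_J : BddAbove (Set.range (J M π)) :=
  ⟨M.Rmax / (1 - M.γ), by rintro _ ⟨θ, rfl⟩; exact (le_abs_self _).trans (abs_J_le θ)⟩

/-- Termwise differentiation is allowed because the gradients are dominated, uniformly in the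
parameter, by a multiple of `γ^t √(t+1)`. -/
theorem Policy.IsELS.hasGradientAt_J (h : π.IsELS G F) (θ : Param d) :
    HasGradientAt (J M π) (∑' t, M.γ ^ t • rewardGrad M π t θ) θ := by
  have hJ : J M π = fun θ => ∑' t, M.γ ^ t * expReward M π t θ := funext J_eq_tsum
  let T := InnerProductSpace.toDual ℝ (Param d)
  have h1 := hasFDerivAt_tsum (f := fun t θ => M.γ ^ t * expReward M π t θ)
    (f' := fun t θ => T (M.γ ^ t • rewardGrad M π t θ)) (x₀ := 0)
    ((summable_pow_mul_sqrt_add_one M.γ_nonneg M.γ_lt_one).mul_left (G * M.Rmax))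
    (fun t θ => by
      have := (h.hasGradientAt_expReward (M := M) t θ).hasFDerivAt.const_mul (M.γ ^ t)
      simpa only [T, map_smul] using this)
    (fun t θ => by
      rw [LinearIsometryEquiv.norm_map]
      exact h.norm_pow_smul_rewardGrad_le t θ)
    (Summable.of_norm_bounded (summable_Rmax_mul_pow M) fun t => by
      rw [norm_mul, Real.norm_of_nonneg (pow_nonneg M.γ_nonneg t), mul_comm]
      exact mul_le_mul_of_nonneg_right (abs_expReward_le t 0) (pow_nonneg M.γ_nonneg t)) θ
  rw [hJ, hasGradientAt_iff_hasFDerivAt]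
  refine h1.congr_fderiv ?_
  exact ((h.summable_rewardGrad (M := M) θ).hasSum.map T T.continuous).tsum_eq

theorem Policy.IsELS.gradient_J (h : π.IsELS G F) (θ : Param d) :
    gradient (J M π) θ = ∑' t, M.γ ^ t • rewardGrad M π t θ :=
  (h.hasGradientAt_J θ).gradient

theorem Policy.IsELS.differentiable_J (h : π.IsELS G F) : Differentiable ℝ (J M π) := fun θ =>
  (h.hasGradientAt_J θ).differentiableAt

theorem Policy.IsELS.norm_pow_smul_rewardGrad_sub_le (h : π.IsELS G F) (t : ℕ) (θ θ' : Param d) :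
    ‖M.γ ^ t • rewardGrad M π t θ' - M.γ ^ t • rewardGrad M π t θ‖ ≤
      (M.Rmax * (G ^ 2 + F) * ‖θ' - θ‖) * (M.γ ^ t * ((t : ℝ) + 1)) := by
  have hγ := M.γ_nonneg
  rw [← smul_sub, norm_smul, Real.norm_of_nonneg (by positivity)]
  calc _ ≤ M.γ ^ t * (M.Rmax * ((t + 1) * (G ^ 2 + F)) * ‖θ' - θ‖) := by
        gcongr; exact h.norm_rewardGrad_sub_le t θ θ'
    _ = _ := by ring

/-- The expected return is `L`-smooth. -/
theorem Policy.IsELS.norm_gradient_J_sub_le (h : π.IsELS G F) (θ θ' : Param d) :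
    ‖gradient (J M π) θ' - gradient (J M π) θ‖ ≤ smoothL M G F * ‖θ' - θ‖ := by
  rw [h.gradient_J, h.gradient_J,
    ← (h.summable_rewardGrad θ').tsum_sub (h.summable_rewardGrad θ)]
  refine (tsum_of_norm_bounded ((hasSum_pow_mul_add_one M.γ_nonneg M.γ_lt_one).mul_left
    (M.Rmax * (G ^ 2 + F) * ‖θ' - θ‖))
    fun t => h.norm_pow_smul_rewardGrad_sub_le t θ θ').trans_eq ?_
  rw [smoothL]
  ring

theorem Policy.IsELS.continuous_gradient_J (h : π.IsELS G F) :
    Continuous (gradient (J M π)) :=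
  (LipschitzWith.of_dist_le' (K := smoothL M G F) fun θ' θ => by
    rw [dist_eq_norm, dist_eq_norm]; exact h.norm_gradient_J_sub_le θ θ').continuous

/-- The difference is the tail of the series. Shifting the index by `H` extracts `γ^H` and leaves
the weighted sum of `√(t + 1 + H)`. -/
theorem Policy.IsELS.norm_gradient_J_sub_truncGrad_le (h : π.IsELS G F) (H : ℕ) (θ : Param d) :
    ‖gradient (J M π) θ - truncGrad M π H θ‖ ≤ truncD' M G H * M.γ ^ H := by
  have hγ := M.γ_nonneg
  have hG := h.G_pos
  have hR := M.Rmax_nonneg π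
  have hr := M.one_sub_γ_pos
  have hs := h.summable_rewardGrad (M := M) θ
  rw [h.gradient_J, truncGrad, ← hs.sum_add_tsum_nat_add H, add_sub_cancel_left]
  refine (tsum_of_norm_bounded ((summable_pow_mul_sqrt M.γ_nonneg M.γ_lt_one H).hasSum.mul_left
    (G * M.Rmax * M.γ ^ H)) fun t => ?_).trans ?_
  · refine (h.norm_pow_smul_rewardGrad_le (t + H) θ).trans_eq ?_
    rw [pow_add]
    push_cast
    rw [add_right_comm]
    ring
  · calc _ ≤ G * M.Rmax * M.γ ^ H * (1 / (1 - M.γ) * √(1 / (1 - M.γ) + H)) := by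
          gcongr
          exact tsum_pow_mul_sqrt_le M.γ_nonneg M.γ_lt_one H
      _ = _ := by rw [truncD']; ring

/-- A bound uniform in `H`, by completing the finite sum to the whole series; multiplied by `D'` it
gives `D`. -/
theorem Policy.IsELS.norm_truncGrad_le (h : π.IsELS G F) (H : ℕ) (θ : Param d) :
    ‖truncGrad M π H θ‖ ≤ G * M.Rmax / (1 - M.γ) ^ (3 / 2 : ℝ) := by
  have hγ := M.γ_nonneg
  have hG := h.G_pos
  have hR := M.Rmax_nonneg π
  have hr := M.one_sub_γ_pos
  have hs := (summable_pow_mul_sqrt_add_one M.γ_nonneg M.γ_lt_one)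
  calc _ ≤ ∑ t ∈ Finset.range H, G * M.Rmax * (M.γ ^ t * √((t : ℝ) + 1)) :=
        norm_sum_le_of_le _ fun t _ => h.norm_pow_smul_rewardGrad_le t θ
    _ ≤ ∑' t : ℕ, G * M.Rmax * (M.γ ^ t * √((t : ℝ) + 1)) :=
        (hs.mul_left _).sum_le_tsum _ fun t _ => by positivity
    _ ≤ G * M.Rmax * (1 / (1 - M.γ) * √(1 / (1 - M.γ))) := by
        rw [tsum_mul_left]
        gcongr
        simpa using tsum_pow_mul_sqrt_le M.γ_nonneg M.γ_lt_one 0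
    _ = _ := by
        have : (1 - M.γ) ^ (3 / 2 : ℝ) = (1 - M.γ) * √(1 - M.γ) := by
          rw [Real.sqrt_eq_rpow, ← Real.rpow_one_add' hr.le (by norm_num)]
          norm_num
        rw [this, one_div, Real.sqrt_inv]
        field_simp

/-! ### Mean and second moment of the single-trajectory estimators. -/

theorem Policy.IsELS.memLp_reward_smul_scoreSum (h : π.IsELS G F) (t n : ℕ) (θ : Param d) :
    MemLp (fun τ => (M.γ ^ t * M.reward (τ t)) • scoreSum π n θ τ) 2 (trajLaw M π θ) := by
  have hb := ((measurable_reward_at M t).const_mul (M.γ ^ t)).aestronglyMeasurable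
    (μ := trajLaw M π θ)
  refine MemLp.of_le_mul (c := M.Rmax * M.γ ^ t) (h.memLp_scoreSum θ n)
    (hb.smul (measurable_scoreSum_at π n θ).aestronglyMeasurable) (ae_of_all _ fun τ => ?_)
  rw [norm_smul]
  exact mul_le_mul_of_nonneg_right (abs_pow_mul_reward_le M t (τ t)) (norm_nonneg _)

theorem gradEst_reinforce (H : ℕ) (θ : Param d) (τ : Traj S A) :
    gradEst M π H .REINFORCE θ τ =
      ∑ t ∈ Finset.range H, (M.γ ^ t * M.reward (τ t)) • scoreSum π H θ τ := by
  rw [← Finset.sum_smul]; rfl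

theorem gradEst_gpomdp (H : ℕ) (θ : Param d) (τ : Traj S A) :
    gradEst M π H .GPOMDP θ τ =
      ∑ t ∈ Finset.range H, (M.γ ^ t * M.reward (τ t)) • scoreSum π (t + 1) θ τ := rfl

theorem Policy.IsELS.memLp_gradEst (h : π.IsELS G F) (e : Estimator) (H : ℕ) (θ : Param d) :
    MemLp (gradEst M π H e θ) 2 (trajLaw M π θ) := by
  cases e with
  | REINFORCE =>
    have : gradEst M π H .REINFORCE θ = fun τ => ∑ t ∈ Finset.range H,
      (M.γ ^ t * M.reward (τ t)) • scoreSum π H θ τ := funext (gradEst_reinforce H θ)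
    rw [this]
    exact memLp_finsetSum _ fun t _ => h.memLp_reward_smul_scoreSum t H θ
  | GPOMDP => exact memLp_finsetSum _ fun t _ => h.memLp_reward_smul_scoreSum t (t + 1) θ

/-- Both estimators are unbiased for the gradient of the truncated return. -/
theorem Policy.IsELS.integral_gradEst (h : π.IsELS G F) (e : Estimator) (H : ℕ) (θ : Param d) :
    ∫ τ, gradEst M π H e θ τ ∂(trajLaw M π θ) = truncGrad M π H θ := by
  have key : ∀ t n, t < n → ∫ τ, (M.γ ^ t * M.reward (τ t)) • scoreSum π n θ τ ∂(trajLaw M π θ) =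
      M.γ ^ t • rewardGrad M π t θ := fun t n htn => by
    simp_rw [mul_smul]
    rw [integral_smul, h.integral_reward_smul_scoreSum htn]
  have hi : ∀ t n, Integrable (fun τ => (M.γ ^ t * M.reward (τ t)) • scoreSum π n θ τ)
      (trajLaw M π θ) := fun t n => (h.memLp_reward_smul_scoreSum t n θ).integrable one_le_two
  cases e with
  | REINFORCE =>
    simp_rw [gradEst_reinforce]
    rw [integral_finsetSum _ fun t _ => hi t H]
    exact Finset.sum_congr rfl fun t ht => key t H (Finset.mem_range.1 ht)
  | GPOMDP =>
    simp_rw [gradEst_gpomdp]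
    rw [integral_finsetSum _ fun t _ => hi t (t + 1)]
    exact Finset.sum_congr rfl fun t _ => key t (t + 1) t.lt_succ_self

theorem sum_pow_le (M : MDP S A) (H : ℕ) :
    ∑ t ∈ Finset.range H, M.γ ^ t ≤ (1 - M.γ)⁻¹ := by
  rw [← tsum_geometric_of_lt_one M.γ_nonneg M.γ_lt_one]
  exact (summable_geometric_of_lt_one M.γ_nonneg M.γ_lt_one).sum_le_tsum _
    fun t _ => pow_nonneg M.γ_nonneg t

/-- For REINFORCE the discounted reward is at most `Rmax / (1 - γ)` and the whole score contributes
`H G²`. For GPOMDP each reward meets only the scores up to its own time, so discounting replaces `H`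
by a power of `1 / (1 - γ)`. -/
theorem Policy.IsELS.integral_gradEst_sq_le (h : π.IsELS G F) (e : Estimator) (H : ℕ)
    (θ : Param d) :
    ∫ τ, ‖gradEst M π H e θ τ‖ ^ 2 ∂(trajLaw M π θ) ≤ varNu M G H e := by
  have hγ := M.γ_nonneg
  have hR := M.Rmax_nonneg π
  have hr := M.one_sub_γ_pos
  have hi := (h.memLp_gradEst (M := M) e H θ).integrable_norm_pow two_ne_zero
  have hS : ∀ n, Integrable (fun τ => ‖scoreSum π n θ τ‖ ^ 2) (trajLaw M π θ) := fun n =>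
    (h.memLp_scoreSum θ n).integrable_norm_pow two_ne_zero
  cases e with
  | REINFORCE =>
    calc _ ≤ ∫ τ, (M.Rmax / (1 - M.γ)) ^ 2 * ‖scoreSum π H θ τ‖ ^ 2 ∂(trajLaw M π θ) := by
          refine integral_mono hi ((hS H).const_mul _) fun τ => ?_
          change ‖(∑ t ∈ Finset.range H, M.γ ^ t * M.reward (τ t)) • scoreSum π H θ τ‖ ^ 2 ≤ _
          rw [norm_smul, mul_pow]
          gcongr
          calc _ ≤ ∑ t ∈ Finset.range H, M.Rmax * M.γ ^ t :=
                  norm_sum_le_of_le _ fun t _ => abs_pow_mul_reward_le M t (τ t)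
            _ ≤ M.Rmax * (1 - M.γ)⁻¹ := by
                rw [← Finset.mul_sum]
                gcongr
                exact sum_pow_le M H
            _ = _ := (div_eq_mul_inv _ _).symm
      _ ≤ (M.Rmax / (1 - M.γ)) ^ 2 * (H * G ^ 2) := by
          rw [integral_const_mul]
          gcongr
          exact h.integral_scoreSum_sq_le θ H
      _ = _ := by rw [varNu]; field_simp
  | GPOMDP =>
    calc _ ≤ ∫ τ, ((1 - M.γ)⁻¹ * M.Rmax ^ 2) * ∑ t ∈ Finset.range H,
          M.γ ^ t * ‖scoreSum π (t + 1) θ τ‖ ^ 2 ∂(trajLaw M π θ) := by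
          refine integral_mono hi ((integrable_finsetSum _ fun t _ =>
            (hS (t + 1)).const_mul _).const_mul _) fun τ => ?_
          simp only [gradEst_gpomdp]
          calc _ ≤ (∑ t ∈ Finset.range H, M.γ ^ t * (M.Rmax * ‖scoreSum π (t + 1) θ τ‖)) ^ 2 := by
                gcongr
                refine norm_sum_le_of_le _ fun t _ => ?_
                rw [norm_smul, ← mul_assoc, mul_comm (M.γ ^ t) M.Rmax]
                gcongr
                exact abs_pow_mul_reward_le M t (τ t)
            -- Cauchy–Schwarz with the weights `γ^t`, so that the second factor keeps `γ^t` to the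
            -- first power.
            _ ≤ (∑ t ∈ Finset.range H, M.γ ^ t) * ∑ t ∈ Finset.range H,
                M.γ ^ t * (M.Rmax * ‖scoreSum π (t + 1) θ τ‖) ^ 2 :=
                Finset.sum_sq_le_sum_mul_sum_of_sq_le_mul _ (fun t _ => by positivity)
                  (fun t _ => by positivity) fun t _ => le_of_eq (by ring)
            _ ≤ (1 - M.γ)⁻¹ * ∑ t ∈ Finset.range H,
                M.γ ^ t * (M.Rmax * ‖scoreSum π (t + 1) θ τ‖) ^ 2 := by
                gcongr
                exact sum_pow_le M H
            _ = _ := by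
                rw [mul_assoc, Finset.mul_sum (a := M.Rmax ^ 2)]
                congr 1
                exact Finset.sum_congr rfl fun t _ => by ring
      _ = ((1 - M.γ)⁻¹ * M.Rmax ^ 2) * ∑ t ∈ Finset.range H,
          M.γ ^ t * ∫ τ, ‖scoreSum π (t + 1) θ τ‖ ^ 2 ∂(trajLaw M π θ) := by
          rw [integral_const_mul, integral_finsetSum _ fun t _ => (hS (t + 1)).const_mul _]
          simp only [integral_const_mul]
      _ ≤ ((1 - M.γ)⁻¹ * M.Rmax ^ 2) * ∑ t ∈ Finset.range H,
          G ^ 2 * (M.γ ^ t * ((t : ℝ) + 1)) := by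
          refine mul_le_mul_of_nonneg_left (Finset.sum_le_sum fun t _ => ?_) (by positivity)
          calc _ ≤ M.γ ^ t * (((t + 1 : ℕ) : ℝ) * G ^ 2) := by
                gcongr
                exact h.integral_scoreSum_sq_le θ (t + 1)
            _ = _ := by push_cast; ring
      _ ≤ ((1 - M.γ)⁻¹ * M.Rmax ^ 2) * (G ^ 2 * (1 / (1 - M.γ) ^ 2)) := by
          rw [← Finset.mul_sum]
          gcongr
          have hs := hasSum_pow_mul_add_one M.γ_nonneg M.γ_lt_one
          rw [← hs.tsum_eq]
          exact hs.summable.sum_le_tsum _ fun t _ => by positivity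
      _ = _ := by rw [varNu]; field_simp

end

/-! Mini-batches. -/

theorem integrable_inner_of_memLp {X E : Type*} [MeasurableSpace X] {μ : Measure X}
    [NormedAddCommGroup E] [InnerProductSpace ℝ E] {f g : X → E} (hf : MemLp f 2 μ)
    (hg : MemLp g 2 μ) : Integrable (fun x => (inner ℝ (f x) (g x) : ℝ)) μ := by
  refine Integrable.mono' ((hf.integrable_norm_pow two_ne_zero).add
    (hg.integrable_norm_pow two_ne_zero)) (hf.1.inner hg.1) (ae_of_all _ fun x => ?_)
  have h := norm_inner_le_norm (𝕜 := ℝ) (f x) (g x)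
  simp only [Pi.add_apply]
  nlinarith [sq_nonneg (‖f x‖ - ‖g x‖), sq_nonneg (‖f x‖), sq_nonneg (‖g x‖)]

/-- The second moment of the mean of `m` independent copies of a random vector. -/
theorem integral_norm_sq_mean {X E : Type*} [MeasurableSpace X] {μ : Measure X}
    [IsProbabilityMeasure μ] [NormedAddCommGroup E] [InnerProductSpace ℝ E] [CompleteSpace E]
    [MeasurableSpace E] [BorelSpace E] {g : X → E} (hg : MemLp g 2 μ) {m : ℕ} (hm : 1 ≤ m) :
    ∫ ω : Fin m → X, ‖(1 / (m : ℝ)) • ∑ i, g (ω i)‖ ^ 2 ∂(Measure.pi fun _ => μ) =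
      1 / m * ∫ x, ‖g x‖ ^ 2 ∂μ + (1 - 1 / m) * ‖∫ x, g x ∂μ‖ ^ 2 := by
  have hm0 : (m : ℝ) ≠ 0 := by positivity
  have hL : ∀ i : Fin m, MemLp (fun ω : Fin m → X => g (ω i)) 2 (Measure.pi fun _ => μ) :=
    fun i => hg.comp_measurePreserving (measurePreserving_eval (fun _ : Fin m => μ) i)
  have hind : iIndepFun (fun (i : Fin m) (ω : Fin m → X) => g (ω i)) (Measure.pi fun _ => μ) :=
    iIndepFun_pi fun _ => hg.1.aemeasurable
  have hE : ∀ i : Fin m, ∫ ω : Fin m → X, g (ω i) ∂(Measure.pi fun _ => μ) = ∫ x, g x ∂μ :=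
    fun i => integral_comp_eval (μ := fun _ : Fin m => μ) hg.1
  -- The `m (m - 1)` off-diagonal inner products factor by independence; the diagonal ones exceed
  -- that value by the variance.
  have hij : ∀ i j : Fin m, ∫ ω : Fin m → X, (inner ℝ (g (ω i)) (g (ω j)) : ℝ)
      ∂(Measure.pi fun _ => μ) =
      ‖∫ x, g x ∂μ‖ ^ 2 + if i = j then ∫ x, ‖g x‖ ^ 2 ∂μ - ‖∫ x, g x ∂μ‖ ^ 2 else 0 := by
    intro i j
    by_cases h : i = j
    · subst h
      simp only [if_true, real_inner_self_eq_norm_sq, add_sub_cancel]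
      exact integral_comp_eval (μ := fun _ : Fin m => μ) (hg.1.norm.pow 2)
    · have h1 : ∫ ω : Fin m → X, (inner ℝ (g (ω i)) (g (ω j)) : ℝ) ∂(Measure.pi fun _ => μ) =
          inner ℝ (∫ ω : Fin m → X, g (ω i) ∂(Measure.pi fun _ => μ))
            (∫ ω : Fin m → X, g (ω j) ∂(Measure.pi fun _ => μ)) :=
        (hind.indepFun h).integral_bilin ((hL i).integrable one_le_two)
          ((hL j).integrable one_le_two) (innerSL ℝ)
      rw [h1, hE, hE, real_inner_self_eq_norm_sq, if_neg h, add_zero]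
  have e : ∀ ω : Fin m → X, ‖(1 / (m : ℝ)) • ∑ i, g (ω i)‖ ^ 2 =
      (1 / (m : ℝ)) ^ 2 * ∑ i, ∑ j, (inner ℝ (g (ω i)) (g (ω j)) : ℝ) := fun ω => by
    rw [norm_smul, mul_pow, Real.norm_eq_abs, sq_abs, ← real_inner_self_eq_norm_sq, sum_inner]
    simp only [inner_sum]
  have hi := fun i j => integrable_inner_of_memLp (hL i) (hL j)
  simp_rw [e]
  rw [integral_const_mul, integral_finsetSum _ fun i _ => integrable_finsetSum _ fun j _ => hi i j]
  simp_rw [integral_finsetSum _ fun j _ => hi _ j, hij]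
  simp only [Finset.sum_add_distrib, Finset.sum_const, Finset.card_univ, Fintype.card_fin,
    Finset.sum_ite_eq, Finset.mem_univ, if_true, nsmul_eq_mul]
  field_simp
  ring

/-! The ascent lemma. -/

/-- The defect of the inequality along the segment is a function `φ` whose derivative is nonnegative
by Cauchy–Schwarz and the Lipschitz bound; the claim is `φ 0 ≤ φ 1`. No integral of the gradient is
involved. -/
theorem sub_le_of_gradient_lipschitz {E : Type*} [NormedAddCommGroup E] [InnerProductSpace ℝ E]
    [CompleteSpace E] {f : E → ℝ} (hf : Differentiable ℝ f) {l : ℝ}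
    (hl : ∀ x y, ‖gradient f y - gradient f x‖ ≤ l * ‖y - x‖) (x v : E) :
    f x + inner ℝ (gradient f x) v - l / 2 * ‖v‖ ^ 2 ≤ f (x + v) := by
  let φ : ℝ → ℝ := fun u => f (x + u • v) - u * inner ℝ (gradient f x) v + l / 2 * ‖v‖ ^ 2 * u ^ 2
  let φ' : ℝ → ℝ := fun u => inner ℝ (gradient f (x + u • v)) v - inner ℝ (gradient f x) v +
    l * ‖v‖ ^ 2 * u
  have hφ : ∀ u, HasDerivAt φ (φ' u) u := by
    intro u
    have h1 := (hf (x + u • v)).hasGradientAt.comp_hasDerivAt (hasDerivAt_add_smul x v u)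
    have h2 := (hasDerivAt_id u).mul_const (inner ℝ (gradient f x) v : ℝ)
    have h3 := ((hasDerivAt_id u).pow 2).const_mul (l / 2 * ‖v‖ ^ 2)
    refine ((h1.sub h2).add h3).congr_deriv ?_
    simp only [φ', id]
    ring
  have hmono : MonotoneOn φ (Set.Ici 0) := by
    refine monotoneOn_of_deriv_nonneg (convex_Ici 0)
      (fun u _ => (hφ u).continuousAt.continuousWithinAt)
      (fun u _ => (hφ u).differentiableAt.differentiableWithinAt) fun u hu => ?_
    rw [interior_Ici, Set.mem_Ioi] at hu
    rw [(hφ u).deriv]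
    have h1 := hl x (x + u • v)
    rw [add_sub_cancel_left, norm_smul, Real.norm_of_nonneg hu.le] at h1
    have h2 := (abs_le.1 (abs_real_inner_le_norm (gradient f (x + u • v) - gradient f x) v)).1
    have h3 := mul_le_mul_of_nonneg_right h1 (norm_nonneg v)
    rw [inner_sub_left] at h2
    simp only [φ']
    nlinarith
  have h := hmono (Set.mem_Ici.2 le_rfl) (Set.mem_Ici.2 zero_le_one) zero_le_one
  simp only [φ, zero_smul, add_zero, one_smul, zero_mul, sub_zero, one_mul, one_pow, mul_one,
    mul_zero, ne_eq, OfNat.ofNat_ne_zero, not_false_eq_true, zero_pow] at h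
  linarith

/-! ### Batch estimates and expected progress of one update. -/

section

variable {d : ℕ} {S : Type u} {A : Type v} [MeasurableSpace S] [MeasurableSpace A]

variable {M : MDP S A} {π : Policy d S A} {G F : ℝ}

theorem Policy.IsELS.memLp_gradEst_eval (h : π.IsELS G F) (e : Estimator) (H : ℕ) {m : ℕ}
    (θ : Param d) (i : Fin m) :
    MemLp (fun τ : Fin m → Traj S A => gradEst M π H e θ (τ i)) 2 (batchLaw M π m θ) :=
  (h.memLp_gradEst e H θ).comp_measurePreserving
    (measurePreserving_eval (fun _ : Fin m => trajLaw M π θ) i)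

theorem Policy.IsELS.memLp_batchGradEst (h : π.IsELS G F) (e : Estimator) (H m : ℕ)
    (θ : Param d) : MemLp (batchGradEst M π e H m θ) 2 (batchLaw M π m θ) :=
  (memLp_finsetSum _ fun i _ => h.memLp_gradEst_eval e H θ i).const_smul (1 / (m : ℝ))

theorem Policy.IsELS.integral_batchGradEst (h : π.IsELS G F) (e : Estimator) (H : ℕ) {m : ℕ}
    (hm : 1 ≤ m) (θ : Param d) :
    ∫ τ, batchGradEst M π e H m θ τ ∂(batchLaw M π m θ) = truncGrad M π H θ := by
  have hm0 : (m : ℝ) ≠ 0 := by positivity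
  have hE : ∀ i : Fin m, ∫ τ : Fin m → Traj S A, gradEst M π H e θ (τ i) ∂(batchLaw M π m θ) =
      truncGrad M π H θ := fun i =>
    (integral_comp_eval (μ := fun _ : Fin m => trajLaw M π θ)
      (h.memLp_gradEst e H θ).1).trans (h.integral_gradEst e H θ)
  unfold batchGradEst
  rw [integral_smul, integral_finsetSum _ fun i _ =>
    (h.memLp_gradEst_eval e H θ i).integrable one_le_two]
  simp only [hE, Finset.sum_const, Finset.card_univ, Fintype.card_fin]
  rw [← Nat.cast_smul_eq_nsmul ℝ, smul_smul, one_div_mul_cancel hm0, one_smul]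

/-- The squared mean is kept rather than bounded: it is later absorbed by the first-order gain,
which is where the factor `1 - 1/m` in `y` comes from. -/
theorem Policy.IsELS.integral_batchGradEst_sq_le (h : π.IsELS G F) (e : Estimator) (H : ℕ) {m : ℕ}
    (hm : 1 ≤ m) (θ : Param d) :
    ∫ τ, ‖batchGradEst M π e H m θ τ‖ ^ 2 ∂(batchLaw M π m θ) ≤
      varNu M G H e / m + (1 - 1 / m) * ‖truncGrad M π H θ‖ ^ 2 := by
  have h1 := integral_norm_sq_mean (h.memLp_gradEst (M := M) e H θ) hm
  rw [h.integral_gradEst] at h1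
  refine h1.trans_le ?_
  rw [div_eq_mul_one_div (varNu M G H e), mul_comm (varNu M G H e)]
  gcongr
  exact h.integral_gradEst_sq_le e H θ

theorem integral_pgKernel (e : Estimator) (H m : ℕ) (η : ℝ) (θ : Param d) {f : Param d → ℝ}
    (hf : Measurable f) :
    ∫ θ', f θ' ∂(pgKernel M π e H m η θ) =
      ∫ τ, f (θ + η • batchGradEst M π e H m θ τ) ∂(batchLaw M π m θ) := by
  have hm : Measurable fun p : Param d × (Fin m → Traj S A) =>
      p.1 + η • batchGradEst M π e H m p.1 p.2 :=
    measurable_fst.add ((measurable_batchGradEst M π e H m).const_smul η)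
  rw [pgKernel, Kernel.map_apply _ hm, Kernel.prod_apply, Kernel.id_apply, Measure.dirac_prod,
    Measure.map_map hm measurable_prodMk_left, integral_map
      (hm.comp measurable_prodMk_left).aemeasurable hf.aestronglyMeasurable]
  rfl

theorem Policy.IsELS.smoothL_nonneg (h : π.IsELS G F) (M : MDP S A) : 0 ≤ smoothL M G F := by
  have hR := M.Rmax_nonneg π
  have hF := h.F_pos
  rw [smoothL]
  positivity

/-- Expected progress of one step of policy gradient. -/
theorem Policy.IsELS.le_integral_J_pgKernel (h : π.IsELS G F) (e : Estimator) (H : ℕ) {m : ℕ}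
    (hm : 1 ≤ m) {η : ℝ} (θ : Param d) :
    J M π θ + η * inner ℝ (gradient (J M π) θ) (truncGrad M π H θ) - smoothL M G F / 2 * η ^ 2 *
        (varNu M G H e / m + (1 - 1 / m) * ‖truncGrad M π H θ‖ ^ 2) ≤
      ∫ θ', J M π θ' ∂(pgKernel M π e H m η θ) := by
  have hL0 := h.smoothL_nonneg M
  have hL := h.memLp_batchGradEst (M := M) e H m θ
  have hi := hL.integrable one_le_two
  have hsq := hL.integrable_norm_pow two_ne_zero
  have hJm : Measurable (J M π) := h.differentiable_J.continuous.measurable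
  have hbm : Measurable (batchGradEst M π e H m θ) :=
    (measurable_batchGradEst M π e H m).comp measurable_prodMk_left
  have hJi : Integrable (fun τ => J M π (θ + η • batchGradEst M π e H m θ τ))
      (batchLaw M π m θ) :=
    Integrable.of_bound (hJm.comp ((hbm.const_smul η).const_add θ)).aestronglyMeasurable
      (M.Rmax / (1 - M.γ)) (ae_of_all _ fun τ => abs_J_le _)
  set g := gradient (J M π) θ with hg
  have h1 : Integrable (fun τ => J M π θ + η * inner ℝ g (batchGradEst M π e H m θ τ))
      (batchLaw M π m θ) := (integrable_const _).add ((hi.const_inner g).const_mul η)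
  have h2 : Integrable (fun τ => smoothL M G F / 2 * η ^ 2 * ‖batchGradEst M π e H m θ τ‖ ^ 2)
      (batchLaw M π m θ) := hsq.const_mul _
  rw [integral_pgKernel e H m η θ hJm]
  calc _ ≤ J M π θ + η * inner ℝ g (truncGrad M π H θ) - smoothL M G F / 2 * η ^ 2 *
        ∫ τ, ‖batchGradEst M π e H m θ τ‖ ^ 2 ∂(batchLaw M π m θ) := by
        gcongr
        exact h.integral_batchGradEst_sq_le e H hm θ
    _ = ∫ τ, (J M π θ + η * inner ℝ g (batchGradEst M π e H m θ τ) -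
          smoothL M G F / 2 * η ^ 2 * ‖batchGradEst M π e H m θ τ‖ ^ 2) ∂(batchLaw M π m θ) := by
        rw [integral_sub h1 h2, integral_add (integrable_const _)
          ((hi.const_inner g).const_mul η), integral_const_mul, integral_const_mul,
          integral_inner hi, h.integral_batchGradEst e H hm]
        simp
    _ ≤ _ := by
        refine integral_mono (h1.sub h2) hJi fun τ => ?_
        have h3 := sub_le_of_gradient_lipschitz (h.differentiable_J (M := M))
          h.norm_gradient_J_sub_le θ (η • batchGradEst M π e H m θ τ)
        rw [real_inner_smul_right, norm_smul, mul_pow, Real.norm_eq_abs, sq_abs] at h3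
        simp only
        linarith

/-! The Markov chain of the iterates. -/

theorem integral_pgLaw_zero (e : Estimator) (H m : ℕ) (η : ℝ) (θ₀ : Param d) {f : Param d → ℝ}
    (hf : Measurable f) : ∫ x, f (x 0) ∂(pgLaw M π e H m η θ₀) = f θ₀ := by
  have h0 : (pgLaw M π e H m η θ₀).map (fun x => x 0) = Measure.dirac θ₀ := by
    have e' : (fun x : ℕ → Param d => x 0) =
        (MeasurableEquiv.piUnique (fun _ : Finset.Iic (0 : ℕ) => Param d)) ∘
          Preorder.frestrictLe (π := fun _ => Param d) 0 := rfl
    rw [e', ← Measure.map_map (MeasurableEquiv.measurable _) (by fun_prop), pgLaw,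
      Kernel.trajMeasure, Measure.map_comp _ _ (by fun_prop), Kernel.traj_map_frestrictLe,
      Kernel.partialTraj_self, Measure.id_comp, MeasurableEquiv.map_map_symm]
  rw [← integral_map (φ := fun x : ℕ → Param d => x 0)
    (measurable_pi_apply 0).aemeasurable hf.aestronglyMeasurable, h0,
    integral_dirac]

instance (e : Estimator) (H m : ℕ) (η : ℝ) (θ₀ : Param d) :
    IsProbabilityMeasure (pgLaw M π e H m η θ₀) := by
  unfold pgLaw; infer_instance

/-- The Markov property of the iterates: disintegrate over the history up to `n`, of which the
update kernel reads only the last entry. -/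
theorem integral_pgLaw_succ (e : Estimator) (H m : ℕ) (η : ℝ) (θ₀ : Param d) (n : ℕ)
    {f : Param d → ℝ} (hf : Measurable f) {K : ℝ} (hK : ∀ θ, |f θ| ≤ K) :
    ∫ x, f (x (n + 1)) ∂(pgLaw M π e H m η θ₀) =
      ∫ x, ∫ θ', f θ' ∂(pgKernel M π e H m η (x n)) ∂(pgLaw M π e H m η θ₀) := by
  have h3 := Kernel.map_frestrictLe_trajMeasure_compProd_eq_map_trajMeasure
    (X := fun _ => Param d) (μ₀ := Measure.dirac θ₀) (κ := pgHistKernel M π e H m η) (a := n)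
  rw [← pgLaw] at h3
  have hP : IsProbabilityMeasure ((pgLaw M π e H m η θ₀).map
      (Preorder.frestrictLe (π := fun _ => Param d) n)) :=
    Measure.isProbabilityMeasure_map (by fun_prop)
  have hfs : Measurable fun p : ((i : Finset.Iic n) → Param d) × Param d => f p.2 :=
    hf.comp measurable_snd
  have hi : Integrable (fun p : ((i : Finset.Iic n) → Param d) × Param d => f p.2)
      ((pgLaw M π e H m η θ₀).map (Preorder.frestrictLe (π := fun _ => Param d) n) ⊗ₘ
        pgHistKernel M π e H m η n) :=
    Integrable.of_bound hfs.aestronglyMeasurable K (ae_of_all _ fun p => hK p.2)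
  calc _ = ∫ p, f p.2 ∂((pgLaw M π e H m η θ₀).map
          fun x => (Preorder.frestrictLe (π := fun _ => Param d) n x, x (n + 1))) := by
        rw [integral_map (by fun_prop) hfs.aestronglyMeasurable]
    _ = ∫ x, ∫ θ', f θ' ∂(pgHistKernel M π e H m η n x)
          ∂((pgLaw M π e H m η θ₀).map (Preorder.frestrictLe (π := fun _ => Param d) n)) := by
        rw [← h3, Measure.integral_compProd hi]
    _ = _ := by
        rw [integral_map (by fun_prop)]
        · rfl
        · exact (StronglyMeasurable.integral_kernel (κ := pgHistKernel M π e H m η n)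
            hf.stronglyMeasurable).aestronglyMeasurable

/-- Telescoping of an expected progress inequality along the iterates. -/
theorem sum_integral_pgLaw_le (e : Estimator) (H m : ℕ) (η : ℝ) (θ₀ : Param d)
    {V W : Param d → ℝ} (hV : Measurable V) (hW : Measurable W) {K K' α b : ℝ}
    (hVK : ∀ θ, |V θ| ≤ K) (hWK : ∀ θ, |W θ| ≤ K')
    (h : ∀ θ, V θ + α * W θ - b ≤ ∫ θ', V θ' ∂(pgKernel M π e H m η θ)) (T : ℕ) :
    α * ∑ t ∈ Finset.range T, ∫ x, W (x t) ∂(pgLaw M π e H m η θ₀) ≤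
      (∫ x, V (x T) ∂(pgLaw M π e H m η θ₀)) - V θ₀ + T * b := by
  have hVi : ∀ t, Integrable (fun x : ℕ → Param d => V (x t)) (pgLaw M π e H m η θ₀) := fun t =>
    Integrable.of_bound (hV.comp (measurable_pi_apply t)).aestronglyMeasurable K
      (ae_of_all _ fun x => hVK (x t))
  have hWi : ∀ t, Integrable (fun x : ℕ → Param d => W (x t)) (pgLaw M π e H m η θ₀) := fun t =>
    Integrable.of_bound (hW.comp (measurable_pi_apply t)).aestronglyMeasurable K'
      (ae_of_all _ fun x => hWK (x t))
  induction T with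
  | zero => simp [integral_pgLaw_zero e H m η θ₀ hV]
  | succ n ih =>
    have hPm : Measurable fun θ => ∫ θ', V θ' ∂(pgKernel M π e H m η θ) :=
      (StronglyMeasurable.integral_kernel hV.stronglyMeasurable).measurable
    have hPi : Integrable (fun x : ℕ → Param d => ∫ θ', V θ' ∂(pgKernel M π e H m η (x n)))
        (pgLaw M π e H m η θ₀) :=
      Integrable.of_bound (hPm.comp (measurable_pi_apply n)).aestronglyMeasurable K
        (ae_of_all _ fun x : ℕ → Param d => by
          have := norm_integral_le_of_norm_le_const (μ := pgKernel M π e H m η (x n))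
            (f := V) (ae_of_all _ hVK)
          simpa using this)
    have hVW : Integrable (fun x : ℕ → Param d => V (x n) + α * W (x n)) (pgLaw M π e H m η θ₀) :=
      (hVi n).add ((hWi n).const_mul α)
    have h1 := integral_mono (f := fun x : ℕ → Param d => V (x n) + α * W (x n) - b)
      (hVW.sub (integrable_const b)) hPi fun x => h (x n)
    rw [← integral_pgLaw_succ e H m η θ₀ n hV hVK] at h1
    have h2 : ∫ x, (V (x n) + α * W (x n) - b) ∂(pgLaw M π e H m η θ₀) =
        (∫ x, V (x n) ∂(pgLaw M π e H m η θ₀)) + α * (∫ x, W (x n) ∂(pgLaw M π e H m η θ₀)) - b := by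
      rw [integral_sub hVW (integrable_const b), integral_add (hVi n) ((hWi n).const_mul α),
        integral_const_mul]
      simp
    rw [h2] at h1
    rw [Finset.sum_range_succ, mul_add]
    push_cast
    linarith

/-! ### The average squared gradient norm. -/

theorem expSqGrad_eq (h : π.IsELS G F) (e : Estimator) (H m : ℕ) (η : ℝ) (θ₀ : Param d) (T : ℕ) :
    expSqGrad M π e H m η θ₀ T = (T : ℝ≥0∞)⁻¹ * ∑ t ∈ Finset.range T,
      ∫⁻ x, ‖gradient (J M π) (x t)‖ₑ ^ 2 ∂(pgLaw M π e H m η θ₀) := by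
  have hm : Measurable fun p : ℕ × (ℕ → Param d) => ‖gradient (J M π) (p.2 p.1)‖ₑ ^ 2 := by
    refine measurable_from_prod_countable_right fun t => ?_
    exact (h.continuous_gradient_J.measurable.comp (measurable_pi_apply t)).enorm.pow_const 2
  have hT : (Set.Iio T) = ((Finset.range T : Finset ℕ) : Set ℕ) := by ext; simp
  rw [expSqGrad, uniformOn, ProbabilityTheory.cond, lintegral_prod _ hm.aemeasurable, lintegral_smul_measure, hT,
    lintegral_finset, Measure.count_apply_finset, Finset.card_range]
  simp

/-- The truncation estimate at `H = 0`, where the truncated gradient is an empty sum. It supplies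
the boundedness that the telescoping argument requires. -/
theorem Policy.IsELS.norm_gradient_J_le (h : π.IsELS G F) (θ : Param d) :
    ‖gradient (J M π) θ‖ ≤ truncD' M G 0 := by
  simpa [truncGrad] using h.norm_gradient_J_sub_truncGrad_le (M := M) 0 θ

theorem truncD_eq (G : ℝ) (H : ℕ) :
    truncD M G H = truncD' M G H * (G * M.Rmax / (1 - M.γ) ^ (3 / 2 : ℝ)) := by
  rw [truncD]; ring

/-- The explicit bound on the average squared gradient norm. -/
theorem Policy.IsELS.expSqGrad_le (h : π.IsELS G F) (e : Estimator) (θ₀ : Param d) (H : ℕ)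
    {m T : ℕ} {η : ℝ} (hm : 1 ≤ m) (hT : 1 ≤ T) (hη : 0 < η)
    (hy : smoothL M G F * η * (1 - 1 / (m : ℝ)) < 2) :
    expSqGrad M π e H m η θ₀ T ≤ ENNReal.ofReal (
      2 * gap M π θ₀ / (η * T * (2 - smoothL M G F * η * (1 - 1 / (m : ℝ)))) +
        smoothL M G F * varNu M G H e * η /
          (m * (2 - smoothL M G F * η * (1 - 1 / (m : ℝ)))) +
        (2 * truncD M G H * (3 - smoothL M G F * η * (1 - 1 / (m : ℝ))) /
            (2 - smoothL M G F * η * (1 - 1 / (m : ℝ))) +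
          truncD' M G H ^ 2 * M.γ ^ H) * M.γ ^ H) := by
  have hm0 : (0 : ℝ) < m := by positivity
  have hT0 : (0 : ℝ) < T := by positivity
  set y := smoothL M G F * η * (1 - 1 / (m : ℝ)) with hydef
  -- The gain `η` less the second-order loss `L η² (1 - 1/m) / 2`; positive because `y < 2`.
  set α := η * (1 - y / 2) with hα
  have hα0 : 0 < α := mul_pos hη (by linarith)
  -- Error per step: passing from `‖g‖²` to `‖∇J‖²`, the bias in `⟨∇J, g⟩`, and the sampling noise.
  -- Dividing by `α = η (2 - y) / 2` turns the two `D` terms into `2 D (3 - y) / (2 - y)`.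
  set b := α * (2 * truncD M G H * M.γ ^ H + (truncD' M G H * M.γ ^ H) ^ 2) +
    η * (truncD M G H * M.γ ^ H) + smoothL M G F / 2 * η ^ 2 * (varNu M G H e / m) with hb
  have hγ := M.γ_nonneg
  have hstep : ∀ θ, J M π θ + α * ‖gradient (J M π) θ‖ ^ 2 - b ≤
      ∫ θ', J M π θ' ∂(pgKernel M π e H m η θ) := by
    intro θ
    refine le_trans ?_ (h.le_integral_J_pgKernel e H hm θ)
    set g := truncGrad M π H θ with hg
    set g' := gradient (J M π) θ with hg'
    have hd : ‖g' - g‖ ≤ truncD' M G H * M.γ ^ H := h.norm_gradient_J_sub_truncGrad_le H θ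
    have hin : |inner ℝ (g' - g) g| ≤ truncD M G H * M.γ ^ H := by
      refine (abs_real_inner_le_norm _ _).trans ?_
      rw [truncD_eq, mul_right_comm]
      exact mul_le_mul hd (h.norm_truncGrad_le H θ) (norm_nonneg _) ((norm_nonneg _).trans hd)
    have e1 : (inner ℝ g' g : ℝ) = inner ℝ (g' - g) g + ‖g‖ ^ 2 := by
      rw [inner_sub_left, real_inner_self_eq_norm_sq]; ring
    have e2 : ‖g'‖ ^ 2 = ‖g' - g‖ ^ 2 + 2 * inner ℝ (g' - g) g + ‖g‖ ^ 2 := by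
      rw [← norm_add_sq_real, sub_add_cancel]
    have hd2 : ‖g' - g‖ ^ 2 ≤ (truncD' M G H * M.γ ^ H) ^ 2 :=
      pow_le_pow_left₀ (norm_nonneg _) hd 2
    have h1 : α * ‖g'‖ ^ 2 ≤ α * (‖g‖ ^ 2 + (2 * truncD M G H * M.γ ^ H +
        (truncD' M G H * M.γ ^ H) ^ 2)) := by
      gcongr
      rw [e2]
      linarith [(abs_le.1 hin).2]
    have h2 : η * (-(truncD M G H * M.γ ^ H)) ≤ η * inner ℝ (g' - g) g := by
      gcongr
      exact (abs_le.1 hin).1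
    have e3 : α * ‖g‖ ^ 2 = η * ‖g‖ ^ 2 -
        smoothL M G F / 2 * η ^ 2 * ((1 - 1 / m) * ‖g‖ ^ 2) := by
      rw [hα, hydef]; ring
    rw [e1, hb]
    linarith
  have hgm : Measurable fun θ => ‖gradient (J M π) θ‖ ^ 2 :=
    h.continuous_gradient_J.measurable.norm.pow_const 2
  have hgb : ∀ θ, |‖gradient (J M π) θ‖ ^ 2| ≤ truncD' M G 0 ^ 2 := fun θ => by
    rw [abs_of_nonneg (sq_nonneg _)]
    exact pow_le_pow_left₀ (norm_nonneg _) (h.norm_gradient_J_le θ) 2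
  have hJm : Measurable (J M π) := h.differentiable_J.continuous.measurable
  have hsum := sum_integral_pgLaw_le e H m η θ₀ hJm hgm (fun θ => abs_J_le θ) hgb hstep T
  have hJT : ∫ x, J M π (x T) ∂(pgLaw M π e H m η θ₀) ≤ Jstar M π := by
    have := integral_mono (μ := pgLaw M π e H m η θ₀) (g := fun _ => Jstar M π)
      (Integrable.of_bound (hJm.comp (measurable_pi_apply T)).aestronglyMeasurable
        (M.Rmax / (1 - M.γ)) (ae_of_all _ fun x => abs_J_le (x T))) (integrable_const _)
      fun x => le_ciSup bddAbove_J (x T)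
    simpa using this
  have hW : ∀ t, ∫⁻ x, ‖gradient (J M π) (x t)‖ₑ ^ 2 ∂(pgLaw M π e H m η θ₀) =
      ENNReal.ofReal (∫ x, ‖gradient (J M π) (x t)‖ ^ 2 ∂(pgLaw M π e H m η θ₀)) := fun t => by
    have hi : Integrable (fun x : ℕ → Param d => ‖gradient (J M π) (x t)‖ ^ 2)
        (pgLaw M π e H m η θ₀) :=
      Integrable.of_bound (C := truncD' M G 0 ^ 2)
        (hgm.comp (measurable_pi_apply t)).aestronglyMeasurable (ae_of_all _ fun x => hgb (x t))
    rw [ofReal_integral_eq_lintegral_ofReal hi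
      (ae_of_all _ fun _ => sq_nonneg _)]
    simp_rw [ENNReal.ofReal_pow (norm_nonneg _), ofReal_norm]
  rw [expSqGrad_eq h]
  simp_rw [hW]
  rw [← ENNReal.ofReal_sum_of_nonneg fun t _ => integral_nonneg fun _ => sq_nonneg _,
    ← ENNReal.ofReal_natCast, ← ENNReal.ofReal_inv_of_pos hT0,
    ← ENNReal.ofReal_mul (by positivity)]
  refine ENNReal.ofReal_le_ofReal ?_
  have h1 : ∑ t ∈ Finset.range T, ∫ x, ‖gradient (J M π) (x t)‖ ^ 2 ∂(pgLaw M π e H m η θ₀) ≤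
      (gap M π θ₀ + T * b) / α := by
    rw [le_div_iff₀ hα0, mul_comm, gap]
    linarith
  refine (mul_le_mul_of_nonneg_left h1 (by positivity)).trans_eq ?_
  have hy2 : 2 - y ≠ 0 := by linarith
  have hα2 : α = η * (2 - y) / 2 := by rw [hα]; ring
  rw [hb, hα2]
  clear_value y
  field_simp
  ring

end

/-! The choice of the parameters. -/

/-- Since `r ≤ exp (-(1 - r))`, the power `r ^ H` is at most the square of `exp (-(1 - r) H / 2)`.
One factor absorbs the linear growth in `H`, the other is at most `ε²`; this is why the horizon
constant is `4`. -/
theorem add_mul_pow_le {r ε : ℝ} (h0 : 0 ≤ r) (h1 : r < 1) (hε : 0 < ε) {H : ℕ}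
    (hH : 4 * Real.log (1 / ε) / (1 - r) ≤ H) :
    (1 / (1 - r) + H) * r ^ H ≤ 3 / (1 - r) * ε ^ 2 := by
  set s := 1 - r with hs
  have hs0 : 0 < s := sub_pos.2 h1
  have hx0 : 0 ≤ s * H / 2 := by positivity
  have e1 : r ^ H ≤ Real.exp (-(s * H / 2)) * Real.exp (-(s * H / 2)) := by
    have h2 : r ≤ Real.exp (-s) := by have := Real.add_one_le_exp (-s); linarith
    calc r ^ H ≤ Real.exp (-s) ^ H := pow_le_pow_left₀ h0 h2 H
      _ = _ := by rw [← Real.exp_nat_mul, ← Real.exp_add]; congr 1; ring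
  have e2 : Real.exp (-(s * H / 2)) ≤ ε ^ 2 := by
    -- For `ε ≥ 1` the horizon condition is void, but the exponential is at most `1 ≤ ε²`.
    rcases le_total ε 1 with h | h
    · have h3 : 4 * Real.log (1 / ε) ≤ H * s := (div_le_iff₀ hs0).1 hH
      rw [one_div, Real.log_inv] at h3
      calc _ ≤ Real.exp (2 * Real.log ε) := Real.exp_le_exp.2 (by linarith)
        _ = ε ^ 2 := by rw [two_mul, Real.exp_add, Real.exp_log hε, sq]
    · exact (Real.exp_le_one_iff.2 (by linarith)).trans (one_le_pow₀ h)
  have e3 : (1 / s + H) * Real.exp (-(s * H / 2)) ≤ 3 / s := by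
    have h4 := Real.add_one_le_exp (s * H / 2)
    rw [Real.exp_neg, ← div_eq_mul_inv, div_le_iff₀ (Real.exp_pos _)]
    calc 1 / s + H ≤ 3 / s * (s * H / 2 + 1) := by
          field_simp
          nlinarith
      _ ≤ _ := by gcongr
  calc (1 / s + H) * r ^ H
      ≤ (1 / s + H) * (Real.exp (-(s * H / 2)) * Real.exp (-(s * H / 2))) := by gcongr
    _ = (1 / s + H) * Real.exp (-(s * H / 2)) * Real.exp (-(s * H / 2)) := by ring
    _ ≤ 3 / s * ε ^ 2 := mul_le_mul e3 e2 (Real.exp_pos _).le (by positivity)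

/-- The constant in the bound `O(ε²)` on the average squared gradient norm. -/
noncomputable def gradConst (G R γ : ℝ) : ℝ :=
  1 + (4 * (G * R / (1 - γ)) * (G * R / (1 - γ) ^ (3 / 2 : ℝ)) + (G * R / (1 - γ)) ^ 2) *
    (3 / (1 - γ))

/-- The constant in the sample complexity. -/
noncomputable def sampleConst (G F R : ℝ) : ℝ :=
  300 * (R ^ 3 * G ^ 2 * (G ^ 2 + F) + G ^ 2 * R ^ 2)

section

variable {d : ℕ} {S : Type u} {A : Type v} [MeasurableSpace S] [MeasurableSpace A]

variable {M : MDP S A} {π : Policy d S A} {G F : ℝ}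

theorem gap_nonneg (θ₀ : Param d) : 0 ≤ gap M π θ₀ :=
  sub_nonneg.2 (le_ciSup bddAbove_J θ₀)

/-- With `x = 1 / (1 - γ) + H ≥ 1` one has `√x ≤ x`, so `D` and `D'²` are both at most linear in
`x`, which `γ ^ H` beats. -/
theorem Policy.IsELS.truncation_le (h : π.IsELS G F) {ε : ℝ} (hε : 0 < ε) {H : ℕ}
    (hH : 4 * Real.log (1 / ε) / (1 - M.γ) ≤ H) :
    (4 * truncD M G H + truncD' M G H ^ 2) * M.γ ^ H ≤
      (gradConst G M.Rmax M.γ - 1) * ε ^ 2 := by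
  have hγ := M.γ_nonneg
  have hR := M.Rmax_nonneg π
  have hG := h.G_pos
  have hs := M.one_sub_γ_pos
  have hx1 : 1 ≤ 1 / (1 - M.γ) + H := by
    have : 1 ≤ 1 / (1 - M.γ) := by rw [le_div_iff₀ hs]; linarith
    have : (0 : ℝ) ≤ H := by positivity
    linarith
  have hb := add_mul_pow_le hγ M.γ_lt_one hε hH
  have hsq : √(1 / (1 - M.γ) + H) ≤ 1 / (1 - M.γ) + H :=
    Real.sqrt_le_iff.2 ⟨by linarith, by nlinarith⟩
  set x := 1 / (1 - M.γ) + (H : ℝ) with hx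
  set a₀ := G * M.Rmax / (1 - M.γ) with ha
  set g₀ := G * M.Rmax / (1 - M.γ) ^ (3 / 2 : ℝ) with hg
  have ha0 : 0 ≤ a₀ := by positivity
  have hg0 : 0 ≤ g₀ := by positivity
  have e1 : truncD' M G H = a₀ * √x := rfl
  have e2 : truncD' M G H ^ 2 = a₀ ^ 2 * x := by
    rw [e1, mul_pow, Real.sq_sqrt (by linarith)]
  calc _ ≤ (4 * (a₀ * x * g₀) + a₀ ^ 2 * x) * M.γ ^ H := by
        rw [e2, truncD_eq, e1]
        gcongr
    _ = (4 * a₀ * g₀ + a₀ ^ 2) * (x * M.γ ^ H) := by ring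
    _ ≤ (4 * a₀ * g₀ + a₀ ^ 2) * (3 / (1 - M.γ) * ε ^ 2) := by gcongr
    _ = _ := by rw [gradConst]; ring

theorem Policy.IsELS.expSqGrad_le_of_parameters (h : π.IsELS G F) (e : Estimator) (θ₀ : Param d)
    {ε : ℝ} (hε : 0 < ε) {H m T : ℕ} (hH : 4 * Real.log (1 / ε) / (1 - M.γ) ≤ H) (hm : 1 ≤ m)
    (hmν : (m : ℝ) ≤ 2 * varNu M G H e / ε ^ 2) (hT : 1 ≤ T)
    (hTm : 8 * gap M π θ₀ * smoothL M G F * varNu M G H e / ε ^ 4 ≤ T * m) :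
    expSqGrad M π e H m (ε ^ 2 * m / (2 * smoothL M G F * varNu M G H e)) θ₀ T ≤
      ENNReal.ofReal (gradConst G M.Rmax M.γ * ε ^ 2) := by
  have hγ := M.γ_nonneg
  have hR := M.Rmax_nonneg π
  have hG := h.G_pos
  have hF := h.F_pos
  have hs := M.one_sub_γ_pos
  have hm0 : (0 : ℝ) < m := by positivity
  have hm1 : (1 : ℝ) ≤ m := by exact_mod_cast hm
  have hT0 : (0 : ℝ) < T := by positivity
  have hmν' : m * ε ^ 2 ≤ 2 * varNu M G H e := (le_div_iff₀ (by positivity)).1 hmν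
  -- The batch condition with `m ≥ 1` excludes `ν = 0`, hence also `Rmax = 0` and `L = 0`, so the
  -- step size is not a division by zero.
  have hν : 0 < varNu M G H e := by
    have : 0 < m * ε ^ 2 := by positivity
    linarith
  have hR0 : 0 < M.Rmax := by
    refine hR.lt_of_ne' fun h0 => hν.ne' ?_
    cases e <;> simp [varNu, h0]
  have hL : 0 < smoothL M G F := by rw [smoothL]; positivity
  have hgap := gap_nonneg (M := M) (π := π) θ₀
  have htr := h.truncation_le (M := M) hε hH
  have hD' : 0 ≤ truncD' M G H := by rw [truncD']; positivity
  have hD : 0 ≤ truncD M G H := by rw [truncD]; positivity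
  have hγH : M.γ ^ H ≤ 1 := pow_le_one₀ hγ M.γ_lt_one.le
  set L := smoothL M G F
  set ν := varNu M G H e
  set δ := gap M π θ₀
  set η := ε ^ 2 * m / (2 * L * ν) with hη
  have hη0 : 0 < η := by positivity
  -- This is exactly the upper bound on the batch size; it gives `y ≤ 1`, so every factor `2 - y`
  -- can be dropped from the denominators.
  have hLη : L * η ≤ 1 := by
    have : L * η = m * ε ^ 2 / (2 * ν) := by rw [hη]; field_simp
    rw [this, div_le_one (by positivity)]
    exact hmν'
  have hq0 : 0 ≤ 1 - 1 / (m : ℝ) := sub_nonneg.2 ((div_le_one hm0).2 hm1)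
  have hq1 : 1 - 1 / (m : ℝ) ≤ 1 := by
    have : 0 ≤ 1 / (m : ℝ) := by positivity
    linarith
  have hy1 : L * η * (1 - 1 / (m : ℝ)) ≤ 1 := mul_le_one₀ hLη hq0 hq1
  refine (h.expSqGrad_le e θ₀ H hm hT hη0 (hy1.trans_lt one_lt_two)).trans
    (ENNReal.ofReal_le_ofReal ?_)
  set y := L * η * (1 - 1 / (m : ℝ))
  have hy2 : 1 ≤ 2 - y := by linarith
  have t1 : 2 * δ / (η * T * (2 - y)) ≤ ε ^ 2 / 2 := by
    calc 2 * δ / (η * T * (2 - y)) ≤ 2 * δ / (η * T) := by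
          exact div_le_div_of_nonneg_left (by positivity) (by positivity)
            (le_mul_of_one_le_right (by positivity) hy2)
      _ ≤ ε ^ 2 / 2 := by
          rw [div_le_iff₀ (by positivity)] at hTm ⊢
          have e1 : ε ^ 2 / 2 * (η * T) = T * m * ε ^ 4 / (4 * L * ν) := by
            rw [hη]; field_simp; ring
          rw [e1, le_div_iff₀ (by positivity)]
          linarith
  have t2 : L * ν * η / (m * (2 - y)) ≤ ε ^ 2 / 2 := by
    calc L * ν * η / (m * (2 - y)) ≤ L * ν * η / m := by
          gcongr
          exact le_mul_of_one_le_right (by positivity) hy2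
      _ = ε ^ 2 / 2 := by rw [hη]; field_simp
  -- For `y ≤ 1` the ratio `(3 - y) / (2 - y)` is at most `2`.
  have t3 : (2 * truncD M G H * (3 - y) / (2 - y) + truncD' M G H ^ 2 * M.γ ^ H) * M.γ ^ H ≤
      (4 * truncD M G H + truncD' M G H ^ 2) * M.γ ^ H := by
    gcongr
    · rw [div_le_iff₀ (by linarith)]
      nlinarith
    · exact mul_le_of_le_one_right (by positivity) hγH
  linarith

/-! ### Sample complexity. -/

theorem Policy.IsELS.sampleConst_ge (h : π.IsELS G F) (M : MDP S A) :
    8 * (M.Rmax ^ 3 * G ^ 2 * (G ^ 2 + F)) ≤ sampleConst G F M.Rmax := by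
  have hR := M.Rmax_nonneg π
  have hF := h.F_pos
  have h1 : 0 ≤ M.Rmax ^ 3 * G ^ 2 * (G ^ 2 + F) := by positivity
  have h2 : 0 ≤ G ^ 2 * M.Rmax ^ 2 := by positivity
  rw [sampleConst]
  linarith

theorem Policy.IsELS.number_of_trajectories_le (h : π.IsELS G F) (θ₀ : Param d) {ε : ℝ}
    (hε : 0 < ε) (H : ℕ) :
    8 * gap M π θ₀ * smoothL M G F * varNu M G H .REINFORCE / ε ^ 4 ≤
        sampleConst G F M.Rmax * gap M π θ₀ * (H / ((1 - M.γ) ^ 4 * ε ^ 4)) ∧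
      8 * gap M π θ₀ * smoothL M G F * varNu M G H .GPOMDP / ε ^ 4 ≤
        sampleConst G F M.Rmax * gap M π θ₀ * (1 / ((1 - M.γ) ^ 5 * ε ^ 4)) := by
  have hs := M.one_sub_γ_pos
  have hgap := gap_nonneg (M := M) (π := π) θ₀
  have hK := h.sampleConst_ge M
  constructor
  · calc _ = 8 * (M.Rmax ^ 3 * G ^ 2 * (G ^ 2 + F)) * gap M π θ₀ *
          (H / ((1 - M.γ) ^ 4 * ε ^ 4)) := by
          rw [smoothL, varNu]; field_simp
      _ ≤ _ := by gcongr
  · calc _ = 8 * (M.Rmax ^ 3 * G ^ 2 * (G ^ 2 + F)) * gap M π θ₀ *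
          (1 / ((1 - M.γ) ^ 5 * ε ^ 4)) := by
          rw [smoothL, varNu]; field_simp
      _ ≤ _ := by gcongr

/-- The rounding error `1` is absorbed since `s ≤ 1 ≤ 2 log (1/ε)`, by `log 2 > 1/2`; this is the
role of `ε ≤ 1/2`. -/
theorem ceil_horizon_le {s ε : ℝ} (hs0 : 0 < s) (hs1 : s ≤ 1) (hε : 0 < ε) (hε2 : ε ≤ 1 / 2) :
    (⌈4 * Real.log (1 / ε) / s⌉₊ : ℝ) ≤ 6 * Real.log (1 / ε) / s := by
  have hl : 1 / 2 ≤ Real.log (1 / ε) := by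
    have h1 : Real.log 2 ≤ Real.log (1 / ε) :=
      Real.log_le_log two_pos (by rw [le_div_iff₀ hε]; linarith)
    linarith [Real.log_two_gt_d9]
  have h2 := (Nat.ceil_lt_add_one (a := 4 * Real.log (1 / ε) / s) (by positivity)).le
  refine h2.trans ?_
  rw [← sub_nonneg]
  have : 6 * Real.log (1 / ε) / s - (4 * Real.log (1 / ε) / s + 1) =
      (2 * Real.log (1 / ε) - s) / s := by field_simp; ring
  rw [this]
  exact div_nonneg (by linarith) hs0.le

/-- For REINFORCE `ν` is itself proportional to `H`, so `H²` appears and the logarithm is squared;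
for GPOMDP only the horizon contributes one. The constant is `6²`, from the rounded horizon. -/
theorem varNu_mul_le (M : MDP S A) (G : ℝ) (e : Estimator) {ε : ℝ} (hε : 0 < ε) (hε2 : ε ≤ 1 / 2)
    {H : ℕ} (hH : (H : ℝ) ≤ 6 * Real.log (1 / ε) / (1 - M.γ)) :
    varNu M G H e * H ≤
      36 * (G ^ 2 * M.Rmax ^ 2) * (Real.log (1 / ε) ^ logPower e / (1 - M.γ) ^ 4) := by
  have hs := M.one_sub_γ_pos
  have hl : 0 ≤ Real.log (1 / ε) :=
    Real.log_nonneg (by rw [le_div_iff₀ hε]; linarith)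
  cases e with
  | REINFORCE =>
    calc _ = G ^ 2 * M.Rmax ^ 2 / (1 - M.γ) ^ 2 * (H : ℝ) ^ 2 := by rw [varNu]; ring
      _ ≤ G ^ 2 * M.Rmax ^ 2 / (1 - M.γ) ^ 2 * (6 * Real.log (1 / ε) / (1 - M.γ)) ^ 2 := by gcongr
      _ = _ := by rw [logPower]; field_simp; ring
  | GPOMDP =>
    calc _ ≤ G ^ 2 * M.Rmax ^ 2 / (1 - M.γ) ^ 3 * (6 * Real.log (1 / ε) / (1 - M.γ)) := by
          rw [varNu]; gcongr
      _ = 6 * (G ^ 2 * M.Rmax ^ 2) * (Real.log (1 / ε) ^ 1 / (1 - M.γ) ^ 4) := by field_simp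
      _ ≤ _ := by
          rw [logPower]
          gcongr
          norm_num

theorem Policy.IsELS.total_sample_complexity (h : π.IsELS G F) (e : Estimator) (θ₀ : Param d)
    {ε : ℝ} (hε : 0 < ε) (hε2 : ε ≤ 1 / 2) {H m : ℕ}
    (hH : H = ⌈4 * Real.log (1 / ε) / (1 - M.γ)⌉₊) (hm : 1 ≤ m)
    (hmν : (m : ℝ) ≤ 2 * varNu M G H e / ε ^ 2) :
    ∃ T : ℕ, 1 ≤ T ∧ 8 * gap M π θ₀ * smoothL M G F * varNu M G H e / ε ^ 4 ≤ T * m ∧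
      (T : ℝ) * m * H ≤ sampleConst G F M.Rmax * (1 + gap M π θ₀) *
        (Real.log (1 / ε) ^ logPower e / ((1 - M.γ) ^ 6 * ε ^ 4)) := by
  have hγ := M.γ_nonneg
  have hR := M.Rmax_nonneg π
  have hF := h.F_pos
  have hs := M.one_sub_γ_pos
  have hs1 : 1 - M.γ ≤ 1 := by linarith
  have hm0 : (0 : ℝ) < m := by positivity
  have hL := h.smoothL_nonneg M
  have hgap := gap_nonneg (M := M) (π := π) θ₀
  have hl : 0 ≤ Real.log (1 / ε) := Real.log_nonneg (by rw [le_div_iff₀ hε]; linarith)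
  have hHle : (H : ℝ) ≤ 6 * Real.log (1 / ε) / (1 - M.γ) := hH ▸ ceil_horizon_le hs hs1 hε hε2
  have hν0 : 0 ≤ varNu M G H e := by cases e <;> (rw [varNu]; positivity)
  have hνH := varNu_mul_le M G e hε hε2 hHle
  set N := 8 * gap M π θ₀ * smoothL M G F * varNu M G H e / ε ^ 4 with hN
  have hN0 : 0 ≤ N := by positivity
  -- Floor plus one rather than ceiling, so that `T ≥ 1` even when the initial gap is zero. The
  -- excess of `T m` over `N` is at most `m ≤ 2ν/ε²`, which accounts for the `1` in `1 + δ₀`.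
  refine ⟨⌊N / m⌋₊ + 1, by omega, ?_, ?_⟩
  · rw [← div_le_iff₀ hm0]
    push_cast
    exact (Nat.lt_floor_add_one _).le
  · have hTm : ((⌊N / m⌋₊ + 1 : ℕ) : ℝ) * m ≤ N + 2 * varNu M G H e / ε ^ 2 := by
      push_cast
      have h1 : (⌊N / m⌋₊ : ℝ) ≤ N / m := Nat.floor_le (by positivity)
      calc ((⌊N / m⌋₊ : ℝ) + 1) * m ≤ (N / m + 1) * m := by gcongr
        _ = N + m := by field_simp
        _ ≤ _ := by gcongr
    have hε4 : 1 / ε ^ 2 ≤ 1 / ε ^ 4 :=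
      one_div_le_one_div_of_le (by positivity)
        (pow_le_pow_of_le_one hε.le (by linarith) (by norm_num))
    have hs2 : 1 ≤ 1 / (1 - M.γ) ^ 2 := by
      rw [le_div_iff₀ (by positivity), one_mul]
      exact pow_le_one₀ hs.le hs1
    set ℓ := Real.log (1 / ε) ^ logPower e with hℓ
    have hℓ0 : 0 ≤ ℓ := by positivity
    calc _ ≤ (N + 2 * varNu M G H e / ε ^ 2) * H := by gcongr
      _ = (varNu M G H e * H) * (8 * gap M π θ₀ * smoothL M G F * (1 / ε ^ 4) +
            2 * (1 / ε ^ 2)) := by rw [hN]; ring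
      _ ≤ (36 * (G ^ 2 * M.Rmax ^ 2) * (ℓ / (1 - M.γ) ^ 4)) *
            (8 * gap M π θ₀ * smoothL M G F * (1 / ε ^ 4) +
              2 * (1 / ε ^ 4) * (1 / (1 - M.γ) ^ 2)) := by
          have h1 : 2 * (1 / ε ^ 2) ≤ 2 * (1 / ε ^ 4) * (1 / (1 - M.γ) ^ 2) :=
            (mul_le_mul_of_nonneg_left hε4 two_pos.le).trans
              (le_mul_of_one_le_right (by positivity) hs2)
          exact mul_le_mul hνH (add_le_add le_rfl h1) (by positivity) (by positivity)
      -- Here `288 = 36 · 8` and `72 = 36 · 2`; both are covered by the `300` in `sampleConst`. The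
      -- power six of `1 - γ` is four from `ν H` and two from `L`.
      _ = (288 * (M.Rmax ^ 3 * G ^ 2 * (G ^ 2 + F)) * gap M π θ₀ + 72 * (G ^ 2 * M.Rmax ^ 2)) *
            (ℓ / ((1 - M.γ) ^ 6 * ε ^ 4)) := by
          rw [smoothL]; field_simp; ring
      _ ≤ _ := by
          refine mul_le_mul_of_nonneg_right ?_ (by positivity)
          have h1 : 0 ≤ M.Rmax ^ 3 * G ^ 2 * (G ^ 2 + F) := by positivity
          have h2 : 0 ≤ G ^ 2 * M.Rmax ^ 2 := by positivity
          have h3 := mul_nonneg h1 hgap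
          have h4 := mul_nonneg h2 hgap
          rw [sampleConst]
          nlinarith

end

end PolicyGradient

theorem mainTheorem9 :
    -- `c` is absolute, `K` depends on `G, F, Rmax` only, `C` depends on `G, F, Rmax, γ` only
    ∃ c : ℝ, 0 < c ∧ ∃ (K : ℝ → ℝ → ℝ → ℝ) (C : ℝ → ℝ → ℝ → ℝ → ℝ),
      ∀ (d : ℕ) (S : Type u) (A : Type v) [MeasurableSpace S] [MeasurableSpace A]
        (M : PolicyGradient.MDP S A) (π : PolicyGradient.Policy d S A) (G F : ℝ), π.IsELS G F →
        -- the gradient of `J` and the supremum `J^*` are meaningful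
        Differentiable ℝ (PolicyGradient.J M π) ∧
        BddAbove (Set.range (PolicyGradient.J M π)) ∧
        ∀ (e : PolicyGradient.Estimator) (θ₀ : PolicyGradient.Param d),
          -- explicit bound for all step sizes `η ∈ (0, 2 / (L (1 - 1/m)))`
          (∀ (H m T : ℕ) (η : ℝ), 1 ≤ m → 1 ≤ T → 0 < η →
            PolicyGradient.smoothL M G F * η * (1 - 1 / (m : ℝ)) < 2 →
            PolicyGradient.expSqGrad M π e H m η θ₀ T ≤ ENNReal.ofReal (
              2 * PolicyGradient.gap M π θ₀ /
                  (η * T * (2 - PolicyGradient.smoothL M G F * η * (1 - 1 / (m : ℝ)))) +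
                PolicyGradient.smoothL M G F * PolicyGradient.varNu M G H e * η /
                  (m * (2 - PolicyGradient.smoothL M G F * η * (1 - 1 / (m : ℝ)))) +
                (2 * PolicyGradient.truncD M G H *
                    (3 - PolicyGradient.smoothL M G F * η * (1 - 1 / (m : ℝ))) /
                    (2 - PolicyGradient.smoothL M G F * η * (1 - 1 / (m : ℝ))) +
                  PolicyGradient.truncD' M G H ^ 2 * M.γ ^ H) * M.γ ^ H)) ∧
          -- the choice of the parameters
          (∀ ε : ℝ, 0 < ε → ∀ H m T : ℕ, c * Real.log (1 / ε) / (1 - M.γ) ≤ H →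
            1 ≤ m → (m : ℝ) ≤ 2 * PolicyGradient.varNu M G H e / ε ^ 2 → 1 ≤ T →
            8 * PolicyGradient.gap M π θ₀ * PolicyGradient.smoothL M G F *
              PolicyGradient.varNu M G H e / ε ^ 4 ≤ T * m →
            PolicyGradient.expSqGrad M π e H m
                (ε ^ 2 * m /
                  (2 * PolicyGradient.smoothL M G F * PolicyGradient.varNu M G H e)) θ₀ T
              ≤ ENNReal.ofReal (C G F M.Rmax M.γ * ε ^ 2)) ∧
          -- the order of the required number `T m` of trajectories
          (∀ ε : ℝ, 0 < ε → ∀ H : ℕ,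
            8 * PolicyGradient.gap M π θ₀ * PolicyGradient.smoothL M G F *
                PolicyGradient.varNu M G H .REINFORCE / ε ^ 4
              ≤ K G F M.Rmax * PolicyGradient.gap M π θ₀ * (H / ((1 - M.γ) ^ 4 * ε ^ 4)) ∧
            8 * PolicyGradient.gap M π θ₀ * PolicyGradient.smoothL M G F *
                PolicyGradient.varNu M G H .GPOMDP / ε ^ 4
              ≤ K G F M.Rmax * PolicyGradient.gap M π θ₀ * (1 / ((1 - M.γ) ^ 5 * ε ^ 4))) ∧
          -- the total sample complexity
          (∀ ε : ℝ, 0 < ε → ε ≤ 1 / 2 → ∀ H m : ℕ, H = ⌈c * Real.log (1 / ε) / (1 - M.γ)⌉₊ →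
            1 ≤ m → (m : ℝ) ≤ 2 * PolicyGradient.varNu M G H e / ε ^ 2 →
            ∃ T : ℕ, 1 ≤ T ∧
              8 * PolicyGradient.gap M π θ₀ * PolicyGradient.smoothL M G F *
                PolicyGradient.varNu M G H e / ε ^ 4 ≤ T * m ∧
              PolicyGradient.expSqGrad M π e H m
                  (ε ^ 2 * m /
                    (2 * PolicyGradient.smoothL M G F * PolicyGradient.varNu M G H e)) θ₀ T
                ≤ ENNReal.ofReal (C G F M.Rmax M.γ * ε ^ 2) ∧
              (T : ℝ) * m * H ≤ K G F M.Rmax * (1 + PolicyGradient.gap M π θ₀) *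
                (Real.log (1 / ε) ^ PolicyGradient.logPower e / ((1 - M.γ) ^ 6 * ε ^ 4))) := by
  -- The value `4` is the horizon constant required by `add_mul_pow_le`.
  refine ⟨4, by norm_num, PolicyGradient.sampleConst,
    fun G _ R γ => PolicyGradient.gradConst G R γ, ?_⟩
  intro d S A _ _ M π G F h
  refine ⟨h.differentiable_J, PolicyGradient.bddAbove_J, fun e θ₀ => ⟨?_, ?_, ?_, ?_⟩⟩
  · intro H m T η hm hT hη hy
    exact h.expSqGrad_le e θ₀ H hm hT hη hy
  · intro ε hε H m T hH hm hmν hT hTm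
    exact h.expSqGrad_le_of_parameters e θ₀ hε hH hm hmν hT hTm
  · intro ε hε H
    exact h.number_of_trajectories_le θ₀ hε H
  · intro ε hε hε2 H m hH hm hmν
    obtain ⟨T, hT, hTm, hc⟩ := h.total_sample_complexity e θ₀ hε hε2 hH hm hmν
    have hH' : 4 * Real.log (1 / ε) / (1 - M.γ) ≤ H := hH ▸ Nat.le_ceil _
    exact ⟨T, hT, hTm, h.expSqGrad_le_of_parameters e θ₀ hε hH' hm hmν hT hTm, hc⟩
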